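/- Let $m\ge 0$, $t>0$ and $H_S(p)=\sqrt{m^2+p^2}-m$. The Salpeter propagator is $$G(x,t)=\lim_{\eta\to0^+}\frac1{2\pi}\int_{-\infty}^{\infty}e^{-iH_S(p)(t-i\eta)+ipx}\,dp\qquad(x\in\mathbb R,\ x\ne\pm t).$$ For $0<\epsilon<t$ let $C_\epsilon$ be the real axis, traversed from left to right, in which the interval $(-t-\epsilon,-t+\epsilon)$ is replaced by the semicircle of radius $\epsilon$ below $-t$ (namely $-t+\epsilon e^{i\theta}$, $\theta$ from $\pi$ to $2\pi$) and $(t-\epsilon,t+\epsilon)$ by the semicircle of radius $\epsilon$ above $t$ (namely $t+\epsilon e^{i\theta}$, $\theta$ from $\pi$ to $0$). Then: (i) The limit defining $G(x,t)$ exists for all real $x\neq\pm t$, and $G(\cdot,t)$ has an analytic continuation $G(z,t)$ to a neighbourhood of the set $S_t=\bigcup_{0<\epsilon<t}C_\epsilon$, whose values on $S_t$ are unique. (ii) Let $\psi_0:\mathbb R\to\mathbb C$ be continuous with compact support, extended to a Borel function $\psi_0:\mathbb C\to\mathbb C$ that is continuous at every real point, and let $x\in\mathbb R$. Put $$\int_C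 G(z,t)\psi_0(x-z)\,dz=\lim_{\epsilon\to0^+}\int_{C_\epsilon}G(z,t)\psi_0(x-z)\,dz,$$ $$PV\!\int_{-\infty}^\infty G(x',t)\psi_0(x-x')\,dx'=\lim_{\epsilon\to0^+}\int_{|x'-t|\ge\epsilon,\ |x'+t|\ge\epsilon}G(x',t)\psi_0(x-x')\,dx'.$$ One of these two limits exists if and only if the other does, and then $$\int_C G(z,t)\psi_0(x-z)\,dz=PV\!\int_{-\infty}^{\infty}G(x',t)\psi_0(x-x')\,dx'+\tfrac12\psi_0(x-t)\,e^{imt}+\tfrac12\psi_0(x+t)\,e^{imt};$$ for $m=0$ the factor $e^{imt}$ is $1$. (iii) If moreover $\psi_0|_{\mathbb R}$ satisfies a Hölder condition at the points $x-t$ and $x+t$, that is, $\psi_0(y)-\psi_0(x\mp t)=O(|y-(x\mp t)|^{\alpha})$ as $y\to x\mp t$, $y \in \mathbb R$, for some $\alpha>0$, then both limits exist. -/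

import Mathlib

open Filter Topology MeasureTheory

noncomputable section

namespace Salpeter

/-- The Salpeter Hamiltonian of a free particle of mass `m` (units `ħ = c = 1`). -/
def hamiltonian (m p : ℝ) : ℝ := √(m ^ 2 + p ^ 2) - m

/-- The momentum integral `(1/2π) ∫ exp(-i H(p) τ + i p x) dp` at the complex time `τ = t - iη`.
It converges absolutely for `η > 0`; the propagator is its limit as `η → 0⁺`. -/
def regularizedPropagator (m t η x : ℝ) : ℂ :=
  1 / (2 * Real.pi) * ∫ p : ℝ, Complex.exp
    (-Complex.I * (hamiltonian m p : ℂ) * ((t : ℂ) - Complex.I * (η : ℂ))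
      + Complex.I * (p : ℂ) * (x : ℂ))

/-- `G` is the value at `(x, t)` of the propagator
`(1/2π) ∫ exp(-i H(p) (t - i0⁺) + i p x) dp`. -/
def IsPropagatorValue (m t x : ℝ) (G : ℂ) : Prop :=
  Tendsto (fun η : ℝ => regularizedPropagator m t η x) (𝓝[>] 0) (𝓝 G)

/-- The points swept by the contours `C_ε`, `0 < ε < t`: the real axis without the light-cone
points `±t`, the punctured lower half-disc at `-t` and the punctured upper half-disc at `t`. -/
def contourRegion (t : ℝ) : Set ℂ :=
  {z | z ≠ (t : ℂ) ∧ z ≠ -(t : ℂ) ∧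
    (z.im = 0 ∨ (0 < z.im ∧ ‖z - (t : ℂ)‖ < t) ∨ (z.im < 0 ∧ ‖z + (t : ℂ)‖ < t))}

/-- `G` is the analytic continuation of the propagator at time `t` from the real axis without
`±t` along the contours `C_ε` (analytic in a neighbourhood of each of their points). -/
structure IsPropagatorContinuation (m t : ℝ) (G : ℂ → ℂ) : Prop where
  analytic : AnalyticOnNhd ℂ G (contourRegion t)
  real_values : ∀ x : ℝ, x ≠ t → x ≠ -t → IsPropagatorValue m t x (G x)

/-- `Ψ` is an extension of the wave function `ψ₀` to complex arguments, continuous (as a function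
on `ℂ`) at every real point. -/
structure IsComplexExtension (ψ₀ : ℝ → ℂ) (Ψ : ℂ → ℂ) : Prop where
  measurable : Measurable Ψ
  extends_real : ∀ y : ℝ, Ψ y = ψ₀ y
  continuousAt_real : ∀ y : ℝ, ContinuousAt Ψ (y : ℂ)

/-- The real axis with the `ε`-neighbourhoods of `±t` removed. -/
def offPoles (t ε : ℝ) : Set ℝ := {y | ε ≤ |y - t| ∧ ε ≤ |y + t|}

/-- The principal value `PV ∫ f(y) dy` with singular points `±t` exists and equals `L`. -/
def HasPrincipalValue (t : ℝ) (f : ℝ → ℂ) (L : ℂ) : Prop :=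
  Tendsto (fun ε : ℝ => ∫ y in offPoles t ε, f y) (𝓝[>] 0) (𝓝 L)

/-- Integral over the semicircle `-t + ε e^{iθ}`, `θ` from `π` to `2π`, which passes below `-t`
from left to right. -/
def lowerArcIntegral (t ε : ℝ) (f : ℂ → ℂ) : ℂ :=
  ∫ θ in Real.pi..(2 * Real.pi),
    f (-(t : ℂ) + ε * Complex.exp (θ * Complex.I)) *
      (Complex.I * ε * Complex.exp (θ * Complex.I))

/-- Integral over the semicircle `t + ε e^{iθ}`, `θ` from `π` to `0`, which passes above `t`
from left to right. -/
def upperArcIntegral (t ε : ℝ) (f : ℂ → ℂ) : ℂ :=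
  ∫ θ in Real.pi..0,
    f ((t : ℂ) + ε * Complex.exp (θ * Complex.I)) *
      (Complex.I * ε * Complex.exp (θ * Complex.I))

/-- Integral over `C_ε`: the real axis from `-∞` to `∞`, indented by the two semicircles. -/
def indentedContourIntegral (t ε : ℝ) (f : ℂ → ℂ) : ℂ :=
  (∫ y in offPoles t ε, f (y : ℂ)) + lowerArcIntegral t ε f + upperArcIntegral t ε f

/-- The integral of `f` along the contour `C`, the limit of `C_ε` as the radius `ε` of the
indentations tends to `0`, exists and equals `L`. -/
def HasContourIntegral (t : ℝ) (f : ℂ → ℂ) (L : ℂ) : Prop :=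
  Tendsto (fun ε : ℝ => indentedContourIntegral t ε f) (𝓝[>] 0) (𝓝 L)

end Salpeter

end

/-!
The positive momenta contribute to the propagator `e^{imτ} / 2π` times the integral over `p > 0` of
`e^{ipw}`, `w = x - τ`, against an amplitude that stays bounded and is `1 + O(|p|^{-1/2})` in the
whole sector `|arg p| ≤ π/4`; the negative momenta contribute the same with `w = -x - τ`.
The ray of integration may therefore be rotated to the direction `1 + i` or `1 - i`, where the
integral converges absolutely for `Im w > -Re w` or `Im w > Re w`; this gives both the limit of
real time and the analytic continuation in `x`. As a Laplace transform of an amplitude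
`1 + O(r^{-1/2})` it equals `i / w + O(|w|^{-1/2})`. Uniqueness is the identity theorem along
segments issuing from the real axis.

On each small semicircle only the simple pole survives, and a clockwise half turn at `t` yields
`-πi` times the residue `i e^{imt} / 2π`, that is `e^{imt} / 2`; the reflection `z ↦ -z` carries the
arc at `-t` to the arc at `t`. So the contour integral and the principal value differ by a
convergent quantity. If `ψ₀` is Hölder, subtracting the poles leaves an integrable function, while
`1 / (y ∓ t)` integrates to `0` over symmetric annuli.
-/

noncomputable section

namespace Salpeter

open Set Asymptotics
open Complex (I exp)

/-! ### Laplace transforms and rotation of the ray of integration -/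

/-- The Laplace transform `∫₀^∞ a(r) e^{-sr} dr`. It is used for `0 < Re s` and amplitudes `a` that
are bounded on `(0, ∞)`; elsewhere the integral may have its default value `0`. -/
def laplaceTransform (a : ℝ → ℂ) (s : ℂ) : ℂ :=
  ∫ r in Ioi (0 : ℝ), a r * exp (-s * r)

lemma norm_exp_neg_mul_ofReal (s : ℂ) (r : ℝ) : ‖exp (-s * r)‖ = Real.exp (-s.re * r) := by
  rw [Complex.norm_exp, Complex.re_mul_ofReal, Complex.neg_re]

lemma integrableOn_exp_neg_mul_Ioi {s : ℂ} (hs : 0 < s.re) :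
    IntegrableOn (fun r : ℝ => exp (-s * r)) (Ioi 0) :=
  integrableOn_exp_mul_complex_Ioi (by simpa using hs) 0

lemma laplaceTransform_const {s : ℂ} (hs : 0 < s.re) (c : ℂ) :
    laplaceTransform (fun _ => c) s = c / s := by
  rw [laplaceTransform, integral_const_mul, integral_exp_mul_complex_Ioi (by simpa using hs)]
  simp [div_eq_mul_inv]

section Laplace

variable {a : ℝ → ℂ} {C : ℝ}

lemma differentiableOn_laplaceTransform (ha : AEStronglyMeasurable a (volume.restrict (Ioi 0)))
    (haC : ∀ r > 0, ‖a r‖ ≤ C) : DifferentiableOn ℂ (laplaceTransform a) {s | 0 < s.re} := by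
  intro s₀ hs₀
  have hδ : 0 < s₀.re / 2 := half_pos hs₀
  have hnhds : {s : ℂ | s₀.re / 2 < s.re} ∈ 𝓝 s₀ :=
    (isOpen_lt continuous_const Complex.continuous_re).mem_nhds
      (show s₀.re / 2 < s₀.re from half_lt_self hs₀)
  have hint : IntegrableOn (fun r => a r * exp (-s₀ * r)) (Ioi 0) :=
    (integrableOn_exp_neg_mul_Ioi hs₀).bdd_mul (c := C) ha
      (ae_restrict_of_forall_mem measurableSet_Ioi haC)
  have hbound : IntegrableOn (fun r : ℝ => C * (r * Real.exp (-(s₀.re / 2) * r))) (Ioi 0) := by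
    simpa [IntegrableOn] using (integrableOn_rpow_mul_exp_neg_mul_rpow (s := 1) (p := 1)
      (by norm_num) one_pos hδ).const_mul C
  refine (hasDerivAt_integral_of_dominated_loc_of_deriv_le
    (F := fun s (r : ℝ) => a r * exp (-s * r)) (F' := fun s (r : ℝ) => a r * (exp (-s * r) * -r))
    hnhds (Eventually.of_forall fun s => ha.mul (by fun_prop)) hint (ha.mul (by fun_prop))
    (ae_restrict_of_forall_mem measurableSet_Ioi fun r hr s hs => ?_) hbound
    (Eventually.of_forall fun r s _ => ?_)).2.differentiableAt.differentiableWithinAt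
  · have hr0 : 0 < r := hr
    have hs' : s₀.re / 2 < s.re := hs
    rw [norm_mul, norm_mul, norm_exp_neg_mul_ofReal, norm_neg, Complex.norm_real,
      Real.norm_of_nonneg hr0.le, mul_comm (Real.exp _)]
    have := haC r hr
    gcongr
    exact (norm_nonneg _).trans this
  · have hlin : HasDerivAt (fun s : ℂ => -s * r) (-r) s := by
      simpa using (hasDerivAt_neg s).mul_const (r : ℂ)
    exact hlin.cexp.const_mul _

lemma tendsto_laplaceTransform {ι : Type*} {l : Filter ι} [l.IsCountablyGenerated]
    {b : ι → ℝ → ℂ} {s : ι → ℂ} {s₀ : ℂ}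
    (hb : ∀ᶠ i in l, AEStronglyMeasurable (b i) (volume.restrict (Ioi 0)))
    (hbC : ∀ᶠ i in l, ∀ r > 0, ‖b i r‖ ≤ C) (hba : ∀ r > 0, Tendsto (b · r) l (𝓝 (a r)))
    (hs : Tendsto s l (𝓝 s₀)) (hs₀ : 0 < s₀.re) :
    Tendsto (fun i => laplaceTransform (b i) (s i)) l (𝓝 (laplaceTransform a s₀)) := by
  have hre : ∀ᶠ i in l, s₀.re / 2 < (s i).re :=
    (Complex.continuous_re.tendsto s₀ |>.comp hs).eventually_const_lt (half_lt_self hs₀)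
  refine tendsto_integral_filter_of_dominated_convergence
    (fun r => C * Real.exp (-(s₀.re / 2) * r)) (hb.mono fun i hi => hi.mul (by fun_prop)) ?_
    ((exp_neg_integrableOn_Ioi 0 (half_pos hs₀)).const_mul C)
    (ae_restrict_of_forall_mem measurableSet_Ioi fun r hr =>
      (hba r hr).mul ((by fun_prop : Continuous fun s : ℂ => exp (-s * r)).tendsto s₀ |>.comp hs))
  filter_upwards [hbC, hre] with i hi hsi
  refine ae_restrict_of_forall_mem measurableSet_Ioi fun r hr => ?_
  have hr0 : 0 < r := hr
  have := hi r hr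
  rw [norm_mul, norm_exp_neg_mul_ofReal]
  gcongr
  exact (norm_nonneg _).trans this

lemma norm_laplaceTransform_sub_div_le (ha : AEStronglyMeasurable a (volume.restrict (Ioi 0)))
    {A β : ℝ} {c s : ℂ} (hβ : β < 1) (hac : ∀ r > 0, ‖a r - c‖ ≤ A * r ^ (-β)) (hs : 0 < s.re) :
    ‖laplaceTransform a s - c / s‖ ≤ A * (s.re ^ (β - 1) * Real.Gamma (1 - β)) := by
  have hbound : IntegrableOn (fun r : ℝ => A * (r ^ (-β) * Real.exp (-s.re * r))) (Ioi 0) := by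
    simpa [IntegrableOn] using (integrableOn_rpow_mul_exp_neg_mul_rpow (s := -β) (p := 1)
      (by linarith) one_pos hs).const_mul A
  have hle : ∀ᵐ r ∂volume.restrict (Ioi (0 : ℝ)),
      ‖(a r - c) * exp (-s * r)‖ ≤ A * (r ^ (-β) * Real.exp (-s.re * r)) := by
    refine ae_restrict_of_forall_mem measurableSet_Ioi fun r hr => ?_
    rw [norm_mul, norm_exp_neg_mul_ofReal, ← mul_assoc]
    gcongr
    exact hac r hr
  have hdiff : IntegrableOn (fun r => (a r - c) * exp (-s * r)) (Ioi 0) :=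
    hbound.mono' ((ha.sub aestronglyMeasurable_const).mul (by fun_prop)) hle
  have hsub : laplaceTransform a s - c / s = ∫ r in Ioi (0 : ℝ), (a r - c) * exp (-s * r) := by
    rw [← laplaceTransform_const hs, sub_eq_iff_eq_add, laplaceTransform, laplaceTransform,
      ← integral_add hdiff ((integrableOn_exp_neg_mul_Ioi hs).const_mul c)]
    simp only [sub_mul, sub_add_cancel]
  have hgamma := Real.integral_rpow_mul_exp_neg_mul_Ioi (a := 1 - β) (by linarith) hs
  rw [one_div, Real.inv_rpow hs.le, ← Real.rpow_neg hs.le, neg_sub, sub_sub_cancel_left] at hgamma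
  calc ‖laplaceTransform a s - c / s‖
      ≤ ∫ r in Ioi (0 : ℝ), A * (r ^ (-β) * Real.exp (-s.re * r)) := by
        rw [hsub]; exact norm_integral_le_of_norm_le hbound hle
    _ = A * (s.re ^ (β - 1) * Real.Gamma (1 - β)) := by
        simp only [integral_const_mul, neg_mul, hgamma]

end Laplace

section RotateRay

variable {f : ℂ → ℂ} {U : Set ℂ} {C δ : ℝ}

lemma integrableOn_ray {d : ℂ} (hUo : IsOpen U) (hf : ContinuousOn f U) (hδ : 0 < δ)
    (hd : ∀ r : ℝ, 0 < r → (r : ℂ) * d ∈ U)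
    (hfC : ∀ r : ℝ, 0 < r → ‖f (r * d)‖ ≤ C * Real.exp (-δ * r)) :
    IntegrableOn (fun r : ℝ => f (r * d) * d) (Ioi 0) := by
  have hcont : ContinuousOn (fun r : ℝ => f (r * d)) (Ioi 0) := fun r hr =>
    ((hf.continuousAt (hUo.mem_nhds (hd r hr))).comp (f := fun r : ℝ => (r : ℂ) * d)
      (by fun_prop)).continuousWithinAt
  exact Integrable.mul_const (((exp_neg_integrableOn_Ioi 0 hδ).const_mul C).mono'
    (hcont.aestronglyMeasurable measurableSet_Ioi)
    (ae_restrict_of_forall_mem measurableSet_Ioi hfC)) d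

lemma norm_primitive_ray_sub_le {Φ : ℂ → ℂ} {d₀ d₁ : ℂ} {r : ℝ} (hr : 0 < r)
    (hΦ : ∀ d ∈ segment ℝ d₀ d₁, HasDerivAt Φ (f (r * d)) (r * d))
    (hfC : ∀ d ∈ segment ℝ d₀ d₁, ‖f (r * d)‖ ≤ C) :
    ‖Φ (r * d₁) - Φ (r * d₀)‖ ≤ C * (r * ‖d₁ - d₀‖) := by
  have hdΦ : ∀ d ∈ segment ℝ d₀ d₁, HasDerivWithinAt (fun d : ℂ => Φ (r * d)) (f (r * d) * r)
      (segment ℝ d₀ d₁) d := fun d hds =>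
    ((hΦ d hds).comp d (hasDerivAt_const_mul (r : ℂ))).hasDerivWithinAt
  rw [← mul_assoc]
  refine (convex_segment d₀ d₁).norm_image_sub_le_of_norm_hasDerivWithin_le hdΦ
    (fun d hds => ?_) (left_mem_segment ℝ d₀ d₁) (right_mem_segment ℝ d₀ d₁)
  rw [norm_mul, Complex.norm_real, Real.norm_of_nonneg hr.le]
  gcongr
  exact hfC d hds

lemma tendsto_exp_neg_mul_mul_nhdsGE_zero (C δ D : ℝ) :
    Tendsto (fun r : ℝ => C * Real.exp (-δ * r) * (r * D)) (𝓝[≥] 0) (𝓝 0) :=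
  (Continuous.tendsto' (by fun_prop) 0 0 (by simp)).mono_left nhdsWithin_le_nhds

lemma tendsto_exp_neg_mul_mul_atTop (C D : ℝ) (hδ : 0 < δ) :
    Tendsto (fun r : ℝ => C * Real.exp (-δ * r) * (r * D)) atTop (𝓝 0) := by
  have h := (tendsto_rpow_mul_exp_neg_mul_atTop_nhds_zero 1 δ hδ).const_mul (C * D)
  rw [mul_zero] at h
  refine h.congr fun r => ?_
  rw [Real.rpow_one]
  ring

lemma integral_ray_eq_integral_ray {d₀ d₁ : ℂ} (hU : Convex ℝ U) (hUo : IsOpen U)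
    (hf : DifferentiableOn ℂ f U) (hδ : 0 < δ)
    (hd : ∀ d ∈ segment ℝ d₀ d₁, ∀ r : ℝ, 0 < r → (r : ℂ) * d ∈ U)
    (hfC : ∀ d ∈ segment ℝ d₀ d₁, ∀ r : ℝ, 0 < r → ‖f (r * d)‖ ≤ C * Real.exp (-δ * r)) :
    ∫ r in Ioi (0 : ℝ), f (r * d₀) * d₀ = ∫ r in Ioi (0 : ℝ), f (r * d₁) * d₁ := by
  have hm₀ := left_mem_segment ℝ d₀ d₁
  have hm₁ := right_mem_segment ℝ d₀ d₁
  have hint₀ := integrableOn_ray hUo hf.continuousOn hδ (hd d₀ hm₀) (hfC d₀ hm₀)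
  have hint₁ := integrableOn_ray hUo hf.continuousOn hδ (hd d₁ hm₁) (hfC d₁ hm₁)
  obtain ⟨Φ, hΦU⟩ := hU.exists_forall_hasDerivWithinAt hf
  have hΦ : ∀ d ∈ segment ℝ d₀ d₁, ∀ r : ℝ, 0 < r → HasDerivAt Φ (f (r * d)) (r * d) :=
    fun d hds r hr => (hΦU _ (hd d hds r hr)).hasDerivAt (hUo.mem_nhds (hd d hds r hr))
  let g : ℝ → ℂ := fun r => Φ (r * d₁) - Φ (r * d₀)
  have hg₀ : g 0 = 0 := by simp [g]
  have hderiv : ∀ r ∈ Ioi (0 : ℝ), HasDerivAt g (f (r * d₁) * d₁ - f (r * d₀) * d₀) r := by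
    intro r hr
    have hray : ∀ d ∈ segment ℝ d₀ d₁,
        HasDerivAt (fun r : ℝ => Φ (r * d)) (f (r * d) * d) r := fun d hds =>
      (hΦ d hds r hr).comp r (by simpa using (Complex.ofRealCLM.hasDerivAt (x := r)).mul_const d)
    exact (hray d₁ hm₁).sub (hray d₀ hm₀)
  have hbound : ∀ r ∈ Ici (0 : ℝ), ‖g r‖ ≤ C * Real.exp (-δ * r) * (r * ‖d₁ - d₀‖) := by
    intro r hr
    obtain rfl | hr := (mem_Ici.1 hr).eq_or_lt
    · simp [hg₀]
    · exact norm_primitive_ray_sub_le hr (hΦ · · r hr) (hfC · · r hr)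
  have hzero : Tendsto g (𝓝[≥] 0) (𝓝 0) :=
    squeeze_zero_norm' (eventually_mem_nhdsWithin.mono hbound)
      (tendsto_exp_neg_mul_mul_nhdsGE_zero C δ ‖d₁ - d₀‖)
  have htop : Tendsto g atTop (𝓝 0) :=
    squeeze_zero_norm' ((eventually_ge_atTop 0).mono hbound)
      (tendsto_exp_neg_mul_mul_atTop C ‖d₁ - d₀‖ hδ)
  have hFTC := integral_Ioi_of_hasDerivAt_of_tendsto (by rwa [ContinuousWithinAt, hg₀]) hderiv
    (hint₁.sub hint₀) htop
  rw [integral_sub hint₁ hint₀, hg₀, sub_self, sub_eq_zero] at hFTC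
  exact hFTC.symm

end RotateRay

/-! ### The energy in a complex sector -/

/-- The sector `|arg p| ≤ π/4`, the range of directions of the rays of integration: the energy
excess is bounded there. -/
def sector : Set ℂ := {p | 0 < p.re ∧ |p.im| ≤ p.re}

lemma ofReal_mul_mem_sector {d : ℂ} (hd : d ∈ sector) {r : ℝ} (hr : 0 < r) :
    (r : ℂ) * d ∈ sector := by
  refine ⟨by simpa using mul_pos hr hd.1, ?_⟩
  rw [Complex.re_ofReal_mul, Complex.im_ofReal_mul, abs_mul, abs_of_pos hr]
  gcongr
  exact hd.2

lemma convex_sector : Convex ℝ sector := by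
  intro p hp q hq a b ha hb hab
  have hre : (a • p + b • q).re = a * p.re + b * q.re := by simp
  have him : (a • p + b • q).im = a * p.im + b * q.im := by simp
  obtain ⟨hp₁, hp₂⟩ := abs_le.1 hp.2
  obtain ⟨hq₁, hq₂⟩ := abs_le.1 hq.2
  refine ⟨convex_halfSpace_re_gt 0 hp.1 hq.1 ha hb hab, ?_⟩
  rw [hre, him, abs_le]
  constructor <;> nlinarith

lemma one_mem_sector : (1 : ℂ) ∈ sector := by simp [sector]

lemma one_add_I_mem_sector : 1 + I ∈ sector := by simp [sector]

lemma one_sub_I_mem_sector : 1 - I ∈ sector := by simp [sector]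

/-- The holomorphic function `√(m² + p²) - p`, by which the energy exceeds that of a massless
particle with momentum `p`. -/
def energyExcess (m : ℝ) (p : ℂ) : ℂ := ((m : ℂ) ^ 2 + p ^ 2) ^ (2⁻¹ : ℂ) - p

lemma re_massShell (m : ℝ) (p : ℂ) :
    ((m : ℂ) ^ 2 + p ^ 2).re = m ^ 2 + (p.re ^ 2 - p.im ^ 2) := by
  simp [pow_two]

lemma massShell_mem_slitPlane (m : ℝ) {p : ℂ} (hp : 0 < p.re) :
    (m : ℂ) ^ 2 + p ^ 2 ∈ Complex.slitPlane := by
  have him : ((m : ℂ) ^ 2 + p ^ 2).im = 2 * (p.re * p.im) := by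
    simp [pow_two]
    ring
  rw [Complex.mem_slitPlane_iff, re_massShell, him]
  obtain h | h := eq_or_ne p.im 0
  · left
    rw [h]
    nlinarith [sq_nonneg m, pow_pos hp 2]
  · right
    positivity

lemma differentiableAt_energyExcess (m : ℝ) {p : ℂ} (hp : 0 < p.re) :
    DifferentiableAt ℂ (energyExcess m) p :=
  (DifferentiableAt.cpow (f := fun p => (m : ℂ) ^ 2 + p ^ 2) (by fun_prop)
    (differentiableAt_const _) (massShell_mem_slitPlane m hp)).sub differentiableAt_id

lemma energyExcess_mul (m : ℝ) (p : ℂ) :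
    energyExcess m p * (((m : ℂ) ^ 2 + p ^ 2) ^ (2⁻¹ : ℂ) + p) = (m : ℂ) ^ 2 := by
  have hsq : (((m : ℂ) ^ 2 + p ^ 2) ^ (2⁻¹ : ℂ)) ^ 2 = (m : ℂ) ^ 2 + p ^ 2 := by simp
  rw [energyExcess]
  linear_combination hsq

lemma energyExcess_ofReal (m p : ℝ) : energyExcess m p = (√(m ^ 2 + p ^ 2) - p : ℝ) := by
  have hsqrt : ((√(m ^ 2 + p ^ 2) : ℝ) : ℂ) = ((m : ℂ) ^ 2 + (p : ℂ) ^ 2) ^ (2⁻¹ : ℂ) := by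
    rw [Real.sqrt_eq_rpow, Complex.ofReal_cpow (by positivity)]
    push_cast
    norm_num
  rw [energyExcess, Complex.ofReal_sub, hsqrt]

lemma abs_le_re_cpow_inv_two {m : ℝ} {q : ℂ} (hq : m ^ 2 ≤ q.re) : |m| ≤ (q ^ (2⁻¹ : ℂ)).re := by
  rw [Complex.cpow_inv_two_re]
  refine Real.abs_le_sqrt ?_
  linarith [Complex.re_le_norm q]

section Sector

variable (m : ℝ) {p : ℂ}

lemma norm_energyExcess_mul_le (hp : p ∈ sector) : ‖energyExcess m p‖ * (|m| + p.re) ≤ m ^ 2 := by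
  have him : p.im ^ 2 ≤ p.re ^ 2 := sq_le_sq.2 (hp.2.trans (le_abs_self _))
  have hroot : |m| ≤ (((m : ℂ) ^ 2 + p ^ 2) ^ (2⁻¹ : ℂ)).re :=
    abs_le_re_cpow_inv_two (by rw [re_massShell]; linarith)
  calc ‖energyExcess m p‖ * (|m| + p.re)
      ≤ ‖energyExcess m p‖ * ‖((m : ℂ) ^ 2 + p ^ 2) ^ (2⁻¹ : ℂ) + p‖ := by
        gcongr
        refine le_trans ?_ (Complex.re_le_norm _)
        rw [Complex.add_re]
        gcongr
    _ = m ^ 2 := by rw [← norm_mul, energyExcess_mul]; simp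

lemma norm_energyExcess_le (hp : p ∈ sector) : ‖energyExcess m p‖ ≤ |m| := by
  have h := norm_energyExcess_mul_le m hp
  have hpos : 0 < |m| + p.re := add_pos_of_nonneg_of_pos (abs_nonneg m) hp.1
  refine le_of_mul_le_mul_right (h.trans ?_) hpos
  nlinarith [sq_abs m, mul_nonneg (abs_nonneg m) hp.1.le]

lemma norm_energyExcess_le_rpow (hp : p ∈ sector) :
    ‖energyExcess m p‖ ≤ √(|m| ^ 3) * p.re ^ (-(1 / 2) : ℝ) := by
  have h₁ := norm_energyExcess_le m hp
  have h₂ : ‖energyExcess m p‖ * p.re ≤ |m| ^ 2 := by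
    rw [sq_abs]
    refine le_trans ?_ (norm_energyExcess_mul_le m hp)
    gcongr
    exact le_add_of_nonneg_left (abs_nonneg m)
  rw [Real.rpow_neg hp.1.le, ← Real.sqrt_eq_rpow, ← div_eq_mul_inv, ← Real.sqrt_div' _ hp.1.le]
  refine Real.le_sqrt_of_sq_le ((le_div_iff₀ hp.1).2 ?_)
  calc ‖energyExcess m p‖ ^ 2 * p.re = ‖energyExcess m p‖ * (‖energyExcess m p‖ * p.re) := by ring
    _ ≤ |m| * |m| ^ 2 :=
        mul_le_mul h₁ h₂ (mul_nonneg (norm_nonneg _) hp.1.le) (abs_nonneg m)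
    _ = |m| ^ 3 := by ring

/-- The factor by which the mass modifies the massless wave `exp(i p w)`, at complex time `τ` and
momentum `p`. -/
def excessPhase (m : ℝ) (τ p : ℂ) : ℂ := exp (-I * energyExcess m p * τ)

variable (τ : ℂ)

lemma differentiableAt_excessPhase (hp : 0 < p.re) : DifferentiableAt ℂ (excessPhase m τ) p :=
  (((differentiableAt_energyExcess m hp).const_mul (-I)).mul_const τ).cexp

lemma norm_excessPhase_le (hp : p ∈ sector) : ‖excessPhase m τ p‖ ≤ Real.exp (|m| * ‖τ‖) := by
  refine (Complex.norm_exp_le_exp_norm _).trans (Real.exp_le_exp.2 ?_)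
  rw [norm_mul, norm_mul, norm_neg, Complex.norm_I, one_mul]
  gcongr
  exact norm_energyExcess_le m hp

lemma norm_excessPhase_sub_one_le (hp : p ∈ sector) :
    ‖excessPhase m τ p - 1‖ ≤
      √(|m| ^ 3) * ‖τ‖ * Real.exp (|m| * ‖τ‖) * p.re ^ (-(1 / 2) : ℝ) := by
  have hnorm : ‖-I * energyExcess m p * τ‖ = ‖energyExcess m p‖ * ‖τ‖ := by simp
  calc ‖excessPhase m τ p - 1‖
      ≤ ‖-I * energyExcess m p * τ‖ * Real.exp ‖-I * energyExcess m p * τ‖ := by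
        simpa [excessPhase] using
          Complex.norm_exp_sub_sum_le_norm_mul_exp (-I * energyExcess m p * τ) 1
    _ ≤ √(|m| ^ 3) * p.re ^ (-(1 / 2) : ℝ) * ‖τ‖ * Real.exp (|m| * ‖τ‖) := by
        have hre := hp.1.le
        rw [hnorm]
        gcongr
        · exact norm_energyExcess_le_rpow m hp
        · exact norm_energyExcess_le m hp
    _ = √(|m| ^ 3) * ‖τ‖ * Real.exp (|m| * ‖τ‖) * p.re ^ (-(1 / 2) : ℝ) := by ring

end Sector

/-- The integral of the wave `excessPhase m τ p * exp(i p w)` over the ray of momenta `p = r d`,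
`0 < r`, written as a Laplace transform. It converges for `d ∈ sector` and `0 < Im (d w)`. -/
def rayIntegral (m : ℝ) (d τ w : ℂ) : ℂ :=
  d * laplaceTransform (fun r => excessPhase m τ (r * d)) (-I * d * w)

section RayIntegral

variable (m : ℝ) {d : ℂ} (τ : ℂ)

lemma re_neg_I_mul_mul (d w : ℂ) : (-I * d * w).re = (d * w).im := by
  simp [mul_assoc]

lemma rayIntegral_eq_integral (d w : ℂ) :
    rayIntegral m d τ w =
      ∫ r in Ioi (0 : ℝ), excessPhase m τ (r * d) * exp (I * (r * d) * w) * d := by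
  rw [rayIntegral, laplaceTransform, mul_comm, ← integral_mul_const]
  congr! 5
  ring_nf

lemma norm_excessPhase_mul_exp_le (hd : d ∈ sector) (w : ℂ) {r : ℝ} (hr : 0 < r) :
    ‖excessPhase m τ (r * d) * exp (I * (r * d) * w)‖ ≤
      Real.exp (|m| * ‖τ‖) * Real.exp (-(d * w).im * r) := by
  have hexp : I * (r * d) * w = -(-I * d * w) * r := by ring
  rw [norm_mul, hexp, norm_exp_neg_mul_ofReal, re_neg_I_mul_mul]
  gcongr
  exact norm_excessPhase_le m τ (ofReal_mul_mem_sector hd hr)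

lemma differentiableOn_excessPhase_mul_exp (w : ℂ) :
    DifferentiableOn ℂ (fun p => excessPhase m τ p * exp (I * p * w)) {p | 0 < p.re} :=
  fun _ hp => ((differentiableAt_excessPhase m τ hp).mul (by fun_prop)).differentiableWithinAt

lemma integrableOn_excessPhase_mul_exp (hd : d ∈ sector) {w : ℂ} (hw : 0 < (d * w).im) :
    IntegrableOn (fun r : ℝ => excessPhase m τ (r * d) * exp (I * (r * d) * w) * d) (Ioi 0) :=
  integrableOn_ray (isOpen_lt continuous_const Complex.continuous_re)
    (differentiableOn_excessPhase_mul_exp m τ w).continuousOn hw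
    (fun _ hr => (ofReal_mul_mem_sector hd hr).1)
    fun _ hr => norm_excessPhase_mul_exp_le m τ hd w hr

lemma aestronglyMeasurable_excessPhase_ray (hd : d ∈ sector) :
    AEStronglyMeasurable (fun r : ℝ => excessPhase m τ (r * d)) (volume.restrict (Ioi 0)) := by
  refine ContinuousOn.aestronglyMeasurable (fun r hr => ?_) measurableSet_Ioi
  have hre := (ofReal_mul_mem_sector hd hr).1
  exact ((differentiableAt_excessPhase m τ hre).continuousAt.comp
    (f := fun r : ℝ => (r : ℂ) * d) (by fun_prop)).continuousWithinAt

lemma differentiableOn_rayIntegral (hd : d ∈ sector) :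
    DifferentiableOn ℂ (rayIntegral m d τ) {w | 0 < (d * w).im} := by
  refine DifferentiableOn.const_mul ?_ d
  refine (differentiableOn_laplaceTransform (aestronglyMeasurable_excessPhase_ray m τ hd)
    fun r hr => norm_excessPhase_le m τ (ofReal_mul_mem_sector hd hr)).comp (by fun_prop) ?_
  exact fun w hw => (re_neg_I_mul_mul d w).symm.subst (motive := (0 < ·)) hw

lemma continuousAt_rayIntegral (hd : d ∈ sector) {w : ℂ} (hw : 0 < (d * w).im) :
    ContinuousAt (fun q : ℂ × ℂ => rayIntegral m d q.1 q.2) (τ, w) := by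
  have hτ : ∀ᶠ q : ℂ × ℂ in 𝓝 (τ, w), ‖q.1‖ < ‖τ‖ + 1 :=
    (continuous_fst.norm.tendsto (τ, w)).eventually_lt_const (lt_add_one _)
  have hτC : ∀ᶠ q : ℂ × ℂ in 𝓝 (τ, w), ∀ r : ℝ, r > 0 →
      ‖excessPhase m q.1 (r * d)‖ ≤ Real.exp (|m| * (‖τ‖ + 1)) := by
    filter_upwards [hτ] with q hq r hr
    refine (norm_excessPhase_le m q.1 (ofReal_mul_mem_sector hd hr)).trans ?_
    gcongr
  have hphase : ∀ p, Continuous fun q : ℂ × ℂ => excessPhase m q.1 p := fun p => by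
    unfold excessPhase
    fun_prop
  have hs : Continuous fun q : ℂ × ℂ => -I * d * q.2 := by fun_prop
  have hlim := tendsto_laplaceTransform
    (Eventually.of_forall fun q : ℂ × ℂ => aestronglyMeasurable_excessPhase_ray m q.1 hd) hτC
    (fun r _ => (hphase (r * d)).tendsto (τ, w)) (hs.tendsto (τ, w))
    (by rwa [re_neg_I_mul_mul])
  exact hlim.const_mul d

lemma rayIntegral_eq_rayIntegral {d₀ d₁ w : ℂ} (hd₀ : d₀ ∈ sector) (hd₁ : d₁ ∈ sector)
    (hw₀ : 0 < (d₀ * w).im) (hw₁ : 0 < (d₁ * w).im) :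
    rayIntegral m d₀ τ w = rayIntegral m d₁ τ w := by
  have hsector : segment ℝ d₀ d₁ ⊆ sector := convex_sector.segment_subset hd₀ hd₁
  have him : ∀ d ∈ segment ℝ d₀ d₁, min (d₀ * w).im (d₁ * w).im ≤ (d * w).im := by
    rintro _ ⟨a, b, ha, hb, hab, rfl⟩
    have hcomb : ((a • d₀ + b • d₁) * w).im = a * (d₀ * w).im + b * (d₁ * w).im := by
      simp
      ring
    rw [hcomb]
    exact Convex.min_le_combo _ _ ha hb hab
  rw [rayIntegral_eq_integral, rayIntegral_eq_integral]
  refine integral_ray_eq_integral_ray (f := fun p => excessPhase m τ p * exp (I * p * w))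
    (C := Real.exp (|m| * ‖τ‖)) (convex_halfSpace_re_gt 0)
    (isOpen_lt continuous_const Complex.continuous_re) (differentiableOn_excessPhase_mul_exp m τ w)
    (lt_min hw₀ hw₁)
    (fun d hd r hr => (ofReal_mul_mem_sector (hsector hd) hr).1) fun d hd r hr => ?_
  refine (norm_excessPhase_mul_exp_le m τ (hsector hd) w hr).trans ?_
  gcongr
  exact him d hd

lemma norm_rayIntegral_sub_le (hd : d ∈ sector) :
    ∃ K : ℝ, 0 ≤ K ∧ ∀ w : ℂ, 0 < (d * w).im →
      ‖rayIntegral m d τ w - I / w‖ ≤ K * (d * w).im ^ (-(1 / 2) : ℝ) := by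
  set A : ℝ := √(|m| ^ 3) * ‖τ‖ * Real.exp (|m| * ‖τ‖) * d.re ^ (-(1 / 2) : ℝ) with hA
  have hre : 0 ≤ d.re := hd.1.le
  refine ⟨‖d‖ * (A * Real.Gamma (1 - 1 / 2)), by positivity, fun w hw => ?_⟩
  have hphase : ∀ r : ℝ, 0 < r → ‖excessPhase m τ (r * d) - 1‖ ≤ A * r ^ (-(1 / 2) : ℝ) := by
    intro r hr
    refine (norm_excessPhase_sub_one_le m τ (ofReal_mul_mem_sector hd hr)).trans_eq ?_
    rw [Complex.re_ofReal_mul, Real.mul_rpow hr.le hre, hA]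
    ring
  have hd₀ : d ≠ 0 := by rintro rfl; simp at hw
  have hw₀ : w ≠ 0 := by rintro rfl; simp at hw
  have hpole : I / w = d * (1 / (-I * d * w)) := by
    field_simp
    simp
  rw [hpole, rayIntegral, ← mul_sub, norm_mul]
  refine (mul_le_mul_of_nonneg_left (norm_laplaceTransform_sub_div_le
    (aestronglyMeasurable_excessPhase_ray m τ hd) (by norm_num) hphase
    (by rwa [re_neg_I_mul_mul])) (norm_nonneg d)).trans_eq ?_
  rw [re_neg_I_mul_mul, show (1 / 2 - 1 : ℝ) = -(1 / 2) by norm_num]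
  ring

end RayIntegral

/-- The contribution of the positive momenta to the propagator at complex time `τ`, continued
analytically in the distance `w` to the light cone by rotating the ray of integration. It is used
for `0 < |Re w| + Im w`. -/
def halfLinePropagator (m : ℝ) (τ w : ℂ) : ℂ :=
  if 0 < ((1 + I) * w).im then rayIntegral m (1 + I) τ w else rayIntegral m (1 - I) τ w

section HalfLine

variable (m : ℝ) (τ : ℂ) {w : ℂ}

lemma im_one_add_I_mul (w : ℂ) : ((1 + I) * w).im = w.im + w.re := by simp

lemma im_one_sub_I_mul (w : ℂ) : ((1 - I) * w).im = w.im - w.re := by simp [sub_eq_add_neg]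

lemma halfLinePropagator_eq_rayIntegral {d : ℂ} (hd : d ∈ sector) (hw : 0 < (d * w).im) :
    halfLinePropagator m τ w = rayIntegral m d τ w := by
  rw [halfLinePropagator]
  split_ifs with h
  · exact rayIntegral_eq_rayIntegral m τ one_add_I_mem_sector hd h hw
  · refine rayIntegral_eq_rayIntegral m τ one_sub_I_mem_sector hd ?_ hw
    obtain ⟨hd₁, hd₂⟩ := abs_le.1 hd.2
    rw [im_one_add_I_mul] at h
    rw [im_one_sub_I_mul]
    rw [Complex.mul_im] at hw
    nlinarith [hd.1]

lemma exists_mem_sector_im_mul_pos (hw : 0 < |w.re| + w.im) : ∃ d ∈ sector, 0 < (d * w).im := by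
  rcases abs_cases w.re with ⟨h, -⟩ | ⟨h, -⟩
  · exact ⟨1 + I, one_add_I_mem_sector, by rw [im_one_add_I_mul]; linarith⟩
  · exact ⟨1 - I, one_sub_I_mem_sector, by rw [im_one_sub_I_mul]; linarith⟩

lemma analyticAt_halfLinePropagator (hw : 0 < |w.re| + w.im) :
    AnalyticAt ℂ (halfLinePropagator m τ) w := by
  obtain ⟨d, hd, hdw⟩ := exists_mem_sector_im_mul_pos hw
  have hnhds : {w : ℂ | 0 < (d * w).im} ∈ 𝓝 w :=
    (isOpen_lt continuous_const (by fun_prop)).mem_nhds hdw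
  refine ((differentiableOn_rayIntegral m τ hd).analyticAt hnhds).congr ?_
  filter_upwards [hnhds] with z hz
  exact (halfLinePropagator_eq_rayIntegral m τ hd hz).symm

lemma continuousAt_halfLinePropagator (hw : 0 < |w.re| + w.im) :
    ContinuousAt (fun q : ℂ × ℂ => halfLinePropagator m q.1 q.2) (τ, w) := by
  obtain ⟨d, hd, hdw⟩ := exists_mem_sector_im_mul_pos hw
  have hnhds : {q : ℂ × ℂ | 0 < (d * q.2).im} ∈ 𝓝 (τ, w) :=
    (isOpen_lt continuous_const (by fun_prop)).mem_nhds hdw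
  refine (continuousAt_rayIntegral m τ hd hdw).congr ?_
  filter_upwards [hnhds] with q hq
  exact (halfLinePropagator_eq_rayIntegral m q.1 hd hq).symm

lemma norm_halfLinePropagator_sub_le_of_norm_le_im {d : ℂ} (hd : d ∈ sector) :
    ∃ K : ℝ, ∀ w : ℂ, w ≠ 0 → ‖w‖ ≤ (d * w).im →
      ‖halfLinePropagator m τ w - I / w‖ ≤ K * ‖w‖ ^ (-(1 / 2) : ℝ) := by
  obtain ⟨K, hK, hbound⟩ := norm_rayIntegral_sub_le m τ hd
  refine ⟨K, fun w hw hdw => ?_⟩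
  have hn : 0 < ‖w‖ := norm_pos_iff.2 hw
  have hpos := hn.trans_le hdw
  rw [halfLinePropagator_eq_rayIntegral m τ hd hpos]
  refine (hbound w hpos).trans (mul_le_mul_of_nonneg_left ?_ hK)
  exact Real.rpow_le_rpow_of_nonpos hn hdw (by norm_num)

lemma norm_halfLinePropagator_sub_le :
    ∃ K : ℝ, ∀ w : ℂ, w ≠ 0 → 0 ≤ w.im →
      ‖halfLinePropagator m τ w - I / w‖ ≤ K * ‖w‖ ^ (-(1 / 2) : ℝ) := by
  obtain ⟨K₁, h₁⟩ := norm_halfLinePropagator_sub_le_of_norm_le_im m τ one_add_I_mem_sector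
  obtain ⟨K₂, h₂⟩ := norm_halfLinePropagator_sub_le_of_norm_le_im m τ one_sub_I_mem_sector
  refine ⟨max K₁ K₂, fun w hw him => ?_⟩
  have hle : ‖w‖ ≤ |w.re| + w.im := by
    simpa [abs_of_nonneg him] using Complex.norm_le_abs_re_add_abs_im w
  rcases abs_cases w.re with ⟨h, -⟩ | ⟨h, -⟩
  · refine (h₁ w hw (by rw [im_one_add_I_mul]; linarith)).trans ?_
    gcongr
    exact le_max_left _ _
  · refine (h₂ w hw (by rw [im_one_sub_I_mul]; linarith)).trans ?_
    gcongr
    exact le_max_right _ _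

end HalfLine

/-! ### Existence and uniqueness of the continuation -/

/-- The integrand of the regularized propagator at complex time `τ`. -/
def planeWave (m : ℝ) (τ : ℂ) (x p : ℝ) : ℂ := exp (-I * (hamiltonian m p : ℂ) * τ + I * p * x)

/-- The analytic continuation of the propagator to complex times `τ` and positions `z`; the two
summands are the contributions of the positive and the negative momenta. -/
def propagator (m : ℝ) (τ z : ℂ) : ℂ :=
  1 / (2 * Real.pi) * (exp (I * m * τ) *
    (halfLinePropagator m τ (z - τ) + halfLinePropagator m τ (-z - τ)))

section Propagator

variable (m : ℝ) {τ : ℂ} (x : ℝ)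

lemma planeWave_neg (τ : ℂ) (p : ℝ) : planeWave m τ x (-p) = planeWave m τ (-x) p := by
  simp [planeWave, hamiltonian]

lemma planeWave_eq (τ : ℂ) (p : ℝ) :
    planeWave m τ x p =
      exp (I * m * τ) * (excessPhase m τ (p * 1) * exp (I * (p * 1) * (x - τ)) * 1) := by
  rw [planeWave, excessPhase, mul_one, mul_one, energyExcess_ofReal, hamiltonian,
    ← Complex.exp_add, ← Complex.exp_add]
  congr 1
  push_cast
  ring

lemma im_one_mul_sub_pos (hτ : τ.im < 0) : 0 < (1 * ((x : ℂ) - τ)).im := by simpa using hτ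

lemma integrableOn_planeWave (hτ : τ.im < 0) : IntegrableOn (planeWave m τ x) (Ioi 0) :=
  ((integrableOn_excessPhase_mul_exp m τ one_mem_sector (im_one_mul_sub_pos x hτ)).const_mul
    (exp (I * m * τ))).congr (Eventually.of_forall fun p => (planeWave_eq m x τ p).symm)

lemma integral_planeWave_Ioi (hτ : τ.im < 0) :
    ∫ p in Ioi (0 : ℝ), planeWave m τ x p =
      exp (I * m * τ) * halfLinePropagator m τ (x - τ) := by
  simp only [planeWave_eq]
  rw [integral_const_mul, ← rayIntegral_eq_integral,
    halfLinePropagator_eq_rayIntegral m τ one_mem_sector (im_one_mul_sub_pos x hτ)]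

lemma integral_planeWave (hτ : τ.im < 0) :
    ∫ p, planeWave m τ x p = (∫ p in Ioi (0 : ℝ), planeWave m τ x p) +
      ∫ p in Ioi (0 : ℝ), planeWave m τ (-x) p := by
  have hneg : IntegrableOn (planeWave m τ x) (Iio 0) := by
    have h := integrableOn_planeWave m (-x) hτ
    rw [← neg_zero] at h
    simpa only [← planeWave_neg, neg_neg] using h.comp_neg_Iio
  have hIic : ∫ p in Iic (0 : ℝ), planeWave m τ x p = ∫ p in Ioi (0 : ℝ), planeWave m τ (-x) p := by
    simpa only [planeWave_neg, neg_zero] using (integral_comp_neg_Ioi 0 (planeWave m τ x)).symm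
  rw [← integrableOn_Iic_iff_integrableOn_Iio] at hneg
  rw [← intervalIntegral.integral_Iic_add_Ioi hneg (integrableOn_planeWave m x hτ), hIic, add_comm]

lemma regularizedPropagator_eq_propagator (t : ℝ) {η : ℝ} (hη : 0 < η) :
    regularizedPropagator m t η x = propagator m (t - I * η) x := by
  have hτ : ((t : ℂ) - I * η).im < 0 := by simpa using hη
  change 1 / (2 * Real.pi) * ∫ p, planeWave m (t - I * η) x p = _
  rw [integral_planeWave m x hτ, integral_planeWave_Ioi m x hτ, integral_planeWave_Ioi m (-x) hτ,
    propagator, Complex.ofReal_neg, mul_add (exp _)]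

end Propagator

section Continuation

variable {m t : ℝ}

lemma neg_mem_contourRegion {z : ℂ} (hz : z ∈ contourRegion t) : -z ∈ contourRegion t := by
  obtain ⟨hpos, hneg, hregion⟩ := hz
  have hsub : ‖-z - (t : ℂ)‖ = ‖z + t‖ := by rw [← norm_neg]; congr 1; ring
  have hadd : ‖-z + (t : ℂ)‖ = ‖z - t‖ := by rw [← norm_neg]; congr 1; ring
  refine ⟨fun h => hneg (by rw [← h, neg_neg]), fun h => hpos (neg_injective h), ?_⟩
  rw [hsub, hadd, Complex.neg_im, neg_eq_zero, neg_pos, neg_lt_zero]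
  tauto

lemma ofReal_mem_contourRegion {x : ℝ} (hpos : x ≠ t) (hneg : x ≠ -t) :
    (x : ℂ) ∈ contourRegion t :=
  ⟨by exact_mod_cast hpos, by exact_mod_cast hneg, Or.inl (Complex.ofReal_im x)⟩

lemma abs_re_sub_add_im_pos {z : ℂ} (hz : z ∈ contourRegion t) :
    0 < |(z - t).re| + (z - t).im := by
  rw [Complex.sub_im, Complex.sub_re, Complex.ofReal_re, Complex.ofReal_im, sub_zero]
  obtain ⟨hzt, -, him | ⟨him, -⟩ | ⟨-, hn⟩⟩ := hz
  · rw [him, add_zero, abs_pos, sub_ne_zero]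
    exact fun hre => hzt (Complex.ext (by simpa using hre) (by simpa using him))
  · positivity
  · have hre := (abs_lt.1 ((Complex.abs_re_le_norm (z + t)).trans_lt hn)).2
    have him := (abs_lt.1 ((Complex.abs_im_le_norm (z + t)).trans_lt hn)).1
    simp only [Complex.add_re, Complex.add_im, Complex.ofReal_re, Complex.ofReal_im,
      add_zero] at hre him
    linarith [neg_le_abs (z.re - t)]

lemma analyticOnNhd_propagator (m t : ℝ) :
    AnalyticOnNhd ℂ (propagator m t) (contourRegion t) := by
  intro z hz
  have hright := (analyticAt_halfLinePropagator m t (abs_re_sub_add_im_pos hz)).fun_comp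
    (f := fun z : ℂ => z - t) (by fun_prop)
  have hleft := (analyticAt_halfLinePropagator m t
    (abs_re_sub_add_im_pos (neg_mem_contourRegion hz))).fun_comp
    (f := fun z : ℂ => -z - t) (by fun_prop)
  exact analyticAt_const.mul (analyticAt_const.mul (hright.add hleft))

lemma continuousAt_propagator_time {x : ℝ} (hpos : x ≠ t) (hneg : x ≠ -t) :
    ContinuousAt (fun τ => propagator m τ x) t := by
  have hx := ofReal_mem_contourRegion hpos hneg
  have hright : ContinuousAt (fun τ : ℂ => halfLinePropagator m τ (x - τ)) t :=
    (continuousAt_halfLinePropagator m t (abs_re_sub_add_im_pos hx)).comp_of_eq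
      (f := fun τ : ℂ => (τ, x - τ)) (by fun_prop) rfl
  have hleft : ContinuousAt (fun τ : ℂ => halfLinePropagator m τ (-x - τ)) t :=
    (continuousAt_halfLinePropagator m t
      (abs_re_sub_add_im_pos (neg_mem_contourRegion hx))).comp_of_eq
      (f := fun τ : ℂ => (τ, -x - τ)) (by fun_prop) rfl
  unfold propagator
  fun_prop

lemma isPropagatorContinuation_propagator (m t : ℝ) :
    IsPropagatorContinuation m t (propagator m t) where
  analytic := analyticOnNhd_propagator m t
  real_values x hpos hneg := by
    have htime : Tendsto (fun η : ℝ => (t : ℂ) - I * η) (𝓝[>] 0) (𝓝 t) :=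
      (Continuous.tendsto' (by fun_prop) 0 _ (by simp)).mono_left nhdsWithin_le_nhds
    refine ((continuousAt_propagator_time hpos hneg).tendsto.comp htime).congr' ?_
    filter_upwards [self_mem_nhdsWithin] with η hη
    exact (regularizedPropagator_eq_propagator m x t hη).symm

end Continuation

/-- The closed upper half-plane without the point `t`: the side from which the contours `C_ε`
approach the singularity at `t`. -/
def puncturedUpper (t : ℝ) : Set ℂ := {z | z ≠ (t : ℂ) ∧ 0 ≤ z.im}

section Uniqueness

variable {m t : ℝ} {G G' : ℂ → ℂ}

lemma mem_contourRegion_of_mem_puncturedUpper {z : ℂ} (hz : z ∈ puncturedUpper t)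
    (hn : ‖z - t‖ < t) : z ∈ contourRegion t := by
  refine ⟨hz.1, ?_, hz.2.eq_or_lt.imp Eq.symm fun him => Or.inl ⟨him, hn⟩⟩
  rintro rfl
  have hre := (Complex.abs_re_le_norm _).trans_lt hn
  simp only [Complex.sub_re, Complex.neg_re, Complex.ofReal_re] at hre
  linarith [(abs_lt.1 hre).1, abs_nonneg (-t - t)]

lemma segment_half_subset_contourRegion {z : ℂ} (him : 0 < z.im) (hn : ‖z - t‖ < t) :
    segment ℝ ((t / 2 : ℝ) : ℂ) z ⊆ contourRegion t := by
  have ht : 0 < t := (norm_nonneg _).trans_lt hn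
  have hhalf : ((t / 2 : ℝ) : ℂ) ∈ Metric.ball (t : ℂ) t := by
    rw [Metric.mem_ball, dist_eq_norm, ← Complex.ofReal_sub, Complex.norm_real, Real.norm_eq_abs,
      abs_lt]
    constructor <;> linarith
  intro w hw
  have hball := (convex_ball (t : ℂ) t).segment_subset hhalf (mem_ball_iff_norm.2 hn) hw
  obtain ⟨a, b, -, hb, hab, rfl⟩ := hw
  have hw_im : (a • ((t / 2 : ℝ) : ℂ) + b • z).im = b * z.im := by simp
  refine mem_contourRegion_of_mem_puncturedUpper ⟨fun hwt => ?_, ?_⟩ (mem_ball_iff_norm.1 hball)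
  · rw [hwt, Complex.ofReal_im] at hw_im
    have hb₀ : b = 0 := (mul_eq_zero.1 hw_im.symm).resolve_right him.ne'
    obtain rfl : a = 1 := by linarith
    have hre := congrArg Complex.re hwt
    simp only [hb₀, one_smul, zero_smul, add_zero, Complex.ofReal_re] at hre
    linarith
  · rw [hw_im]
    positivity

lemma IsPropagatorContinuation.eq_ofReal (hG : IsPropagatorContinuation m t G)
    (hG' : IsPropagatorContinuation m t G') {x : ℝ} (hpos : x ≠ t) (hneg : x ≠ -t) :
    G x = G' x :=
  tendsto_nhds_unique (hG.real_values x hpos hneg) (hG'.real_values x hpos hneg)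

lemma IsPropagatorContinuation.eq_of_segment_subset (hG : IsPropagatorContinuation m t G)
    (hG' : IsPropagatorContinuation m t G') {x : ℝ} {z : ℂ}
    (hs : segment ℝ (x : ℂ) z ⊆ contourRegion t) : G z = G' z := by
  have hx := hs (left_mem_segment ℝ _ _)
  have hreal : ∀ᶠ y : ℝ in 𝓝[≠] x, G y = G' y := by
    filter_upwards [nhdsWithin_le_nhds (eventually_ne_nhds (a := x) (b := t) (by
      simpa using hx.1)), nhdsWithin_le_nhds (eventually_ne_nhds (a := x) (b := -t) (by
      exact_mod_cast hx.2.1))] with y hpos hneg using hG.eq_ofReal hG' hpos hneg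
  have htend : Tendsto (fun y : ℝ => (y : ℂ)) (𝓝[≠] x) (𝓝[≠] (x : ℂ)) :=
    (Complex.continuous_ofReal.tendsto x).inf
      (tendsto_principal_principal.2 fun y hy => by simpa using hy)
  exact (hG.analytic.mono hs).eqOn_of_preconnected_of_frequently_eq (hG'.analytic.mono hs)
    (convex_segment _ _).isPreconnected (left_mem_segment ℝ _ _)
    (htend.frequently hreal.frequently) (right_mem_segment ℝ _ _)

lemma regularizedPropagator_neg (m t η x : ℝ) :
    regularizedPropagator m t η (-x) = regularizedPropagator m t η x := by
  change _ * ∫ p, planeWave m (t - I * η) (-x) p = _ * ∫ p, planeWave m (t - I * η) x p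
  simp only [← planeWave_neg, integral_neg_eq_self (planeWave m (t - I * η) x) volume]

lemma IsPropagatorContinuation.comp_neg (hG : IsPropagatorContinuation m t G) :
    IsPropagatorContinuation m t fun z => G (-z) where
  analytic z hz := (hG.analytic (-z) (neg_mem_contourRegion hz)).fun_comp
    (f := fun z : ℂ => -z) (by fun_prop)
  real_values x hpos hneg := by
    have h := hG.real_values (-x) (fun h => hneg (neg_eq_iff_eq_neg.1 h)) (neg_injective.ne hpos)
    simpa only [IsPropagatorValue, regularizedPropagator_neg, Complex.ofReal_neg] using h

lemma IsPropagatorContinuation.eq_of_im_pos (hG : IsPropagatorContinuation m t G)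
    (hG' : IsPropagatorContinuation m t G') {z : ℂ} (him : 0 < z.im) (hn : ‖z - t‖ < t) :
    G z = G' z :=
  hG.eq_of_segment_subset hG' (segment_half_subset_contourRegion him hn)

lemma IsPropagatorContinuation.eqOn (hG : IsPropagatorContinuation m t G)
    (hG' : IsPropagatorContinuation m t G') : EqOn G G' (contourRegion t) := by
  rintro z ⟨hpos, hneg, him | ⟨him, hn⟩ | ⟨him, hn⟩⟩
  · lift z to ℝ using him
    exact hG.eq_ofReal hG' (by exact_mod_cast hpos) (by exact_mod_cast hneg)
  · exact hG.eq_of_im_pos hG' him hn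
  · have hn' : ‖-z - (t : ℂ)‖ < t := by rwa [← norm_neg, neg_sub', neg_neg, sub_neg_eq_add]
    simpa using hG.comp_neg.eq_of_im_pos hG'.comp_neg (z := -z) (by simpa using him) hn'

end Uniqueness

/-! ### Residues on the small semicircles -/

/-- The residue of the propagator at `t`. -/
def poleCoeff (m t : ℝ) : ℂ := I / (2 * Real.pi) * exp (I * m * t)

lemma isBigO_one_norm_sub_rpow {a : ℂ} {β : ℝ} (hβ : β ≤ 0) :
    (fun _ : ℂ => (1 : ℝ)) =O[𝓝[≠] a] fun z => ‖z - a‖ ^ β := by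
  refine IsBigO.of_bound 1 ?_
  filter_upwards [self_mem_nhdsWithin, nhdsWithin_le_nhds (Metric.ball_mem_nhds a one_pos)]
    with z hne hz
  have hpos : 0 < ‖z - a‖ := norm_pos_iff.2 (sub_ne_zero.2 hne)
  rw [norm_one, one_mul, Real.norm_of_nonneg (by positivity)]
  exact Real.one_le_rpow_of_pos_of_le_one_of_nonpos hpos (mem_ball_iff_norm.1 hz).le hβ

section Pole

variable {m t : ℝ} {G : ℂ → ℂ}

lemma nhdsWithin_puncturedUpper_le : 𝓝[puncturedUpper t] (t : ℂ) ≤ 𝓝[≠] (t : ℂ) :=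
  nhdsWithin_mono _ fun _ hz => hz.1

lemma eventually_mem_contourRegion (ht : 0 < t) :
    ∀ᶠ z in 𝓝[puncturedUpper t] (t : ℂ), z ∈ contourRegion t := by
  filter_upwards [self_mem_nhdsWithin, nhdsWithin_le_nhds (Metric.ball_mem_nhds (t : ℂ) ht)]
    with z hz hn using mem_contourRegion_of_mem_puncturedUpper hz (mem_ball_iff_norm.1 hn)

lemma isBigO_propagator_sub_pole (m : ℝ) (ht : 0 < t) :
    (fun z : ℂ => propagator m t z - poleCoeff m t / (z - t)) =O[𝓝[puncturedUpper t] (t : ℂ)]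
      (fun z : ℂ => ‖z - t‖ ^ (-(1 / 2) : ℝ)) := by
  obtain ⟨K, hK⟩ := norm_halfLinePropagator_sub_le m t
  have hright : (fun z : ℂ => halfLinePropagator m t (z - t) - I / (z - t))
      =O[𝓝[puncturedUpper t] (t : ℂ)] (fun z : ℂ => ‖z - t‖ ^ (-(1 / 2) : ℝ)) := by
    refine IsBigO.of_bound K ?_
    filter_upwards [self_mem_nhdsWithin] with z hz
    rw [Real.norm_of_nonneg (by positivity)]
    exact hK _ (sub_ne_zero.2 hz.1) (by simpa using hz.2)
  have hcont : ContinuousAt (fun z : ℂ => halfLinePropagator m t (-z - t)) (t : ℂ) := by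
    refine (analyticAt_halfLinePropagator m t (w := -(t : ℂ) - t) ?_).continuousAt.comp
      (f := fun z : ℂ => -z - t) (by fun_prop)
    simp only [Complex.sub_re, Complex.neg_re, Complex.ofReal_re, Complex.sub_im, Complex.neg_im,
      Complex.ofReal_im, neg_zero, sub_zero, add_zero]
    exact abs_pos_of_neg (by linarith)
  have hleft : (fun z : ℂ => halfLinePropagator m t (-z - t))
      =O[𝓝[puncturedUpper t] (t : ℂ)] (fun z : ℂ => ‖z - t‖ ^ (-(1 / 2) : ℝ)) :=
    ((hcont.tendsto.mono_left nhdsWithin_le_nhds).isBigO_one ℝ).trans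
      ((isBigO_one_norm_sub_rpow (by norm_num)).mono nhdsWithin_puncturedUpper_le)
  refine ((hright.add hleft).const_mul_left
    (1 / (2 * Real.pi) * exp (I * m * t))).congr_left fun z => ?_
  rw [propagator, poleCoeff]
  ring

lemma IsPropagatorContinuation.isBigO_sub_pole (hG : IsPropagatorContinuation m t G)
    (ht : 0 < t) :
    (fun z : ℂ => G z - poleCoeff m t / (z - t)) =O[𝓝[puncturedUpper t] (t : ℂ)]
      (fun z : ℂ => ‖z - t‖ ^ (-(1 / 2) : ℝ)) := by
  refine (isBigO_propagator_sub_pole m ht).congr' ?_ EventuallyEq.rfl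
  filter_upwards [eventually_mem_contourRegion ht] with z hz
  rw [hG.eqOn (isPropagatorContinuation_propagator m t) hz]

lemma IsPropagatorContinuation.tendsto_sub_mul (hG : IsPropagatorContinuation m t G)
    (ht : 0 < t) :
    Tendsto (fun z : ℂ => (z - t) * G z) (𝓝[puncturedUpper t] (t : ℂ)) (𝓝 (poleCoeff m t)) := by
  have hbig : (fun z : ℂ => (z - t) * (G z - poleCoeff m t / (z - t)))
      =O[𝓝[puncturedUpper t] (t : ℂ)] (fun z : ℂ => ‖z - t‖ ^ (1 / 2 : ℝ)) := by
    refine ((isBigO_refl (fun z : ℂ => z - t) _).norm_right.mul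
      (hG.isBigO_sub_pole ht)).congr' EventuallyEq.rfl ?_
    filter_upwards [self_mem_nhdsWithin] with z hz
    have hpos : 0 < ‖z - t‖ := norm_pos_iff.2 (sub_ne_zero.2 hz.1)
    rw [mul_comm, ← Real.rpow_add_one hpos.ne']
    norm_num
  have hzero : Tendsto (fun z : ℂ => ‖z - t‖ ^ (1 / 2 : ℝ)) (𝓝[puncturedUpper t] (t : ℂ))
      (𝓝 0) := by
    have hcont : Continuous fun z : ℂ => ‖z - t‖ ^ (1 / 2 : ℝ) :=
      (by fun_prop : Continuous fun z : ℂ => ‖z - t‖).rpow_const fun _ => Or.inr (by norm_num)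
    exact (hcont.tendsto' _ _ (by simp)).mono_left nhdsWithin_le_nhds
  have hadd := (hbig.trans_tendsto hzero).add_const (poleCoeff m t)
  rw [zero_add] at hadd
  refine hadd.congr' ?_
  filter_upwards [self_mem_nhdsWithin] with z hz
  rw [mul_sub, mul_div_cancel₀ _ (sub_ne_zero.2 hz.1), sub_add_cancel]

end Pole

section Arcs

variable {m t : ℝ} {f G Φ : ℂ → ℂ} {c : ℂ}

lemma circleMap_mem_puncturedUpper {ε θ : ℝ} (hε : 0 < ε) (hθ : θ ∈ Ioc 0 Real.pi) :
    circleMap t ε θ ∈ puncturedUpper t := by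
  refine ⟨circleMap_ne_center hε.ne', ?_⟩
  have hsin : 0 ≤ Real.sin θ := Real.sin_nonneg_of_nonneg_of_le_pi hθ.1.le hθ.2
  simp only [circleMap, Complex.add_im, Complex.ofReal_im, zero_add, Complex.im_ofReal_mul,
    Complex.exp_ofReal_mul_I_im]
  positivity

lemma norm_circleMap_sub {ε : ℝ} (hε : 0 ≤ ε) (θ : ℝ) : ‖circleMap t ε θ - t‖ = ε := by
  rw [circleMap_sub_center, norm_circleMap_zero, abs_of_nonneg hε]

lemma upperArcIntegral_eq (t ε : ℝ) (f : ℂ → ℂ) :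
    upperArcIntegral t ε f =
      ∫ θ in Real.pi..0, I * ((circleMap t ε θ - t) * f (circleMap t ε θ)) := by
  refine intervalIntegral.integral_congr fun θ _ => ?_
  simp only [circleMap]
  ring

lemma lowerArcIntegral_eq_upperArcIntegral (t ε : ℝ) (f : ℂ → ℂ) :
    lowerArcIntegral t ε f = upperArcIntegral t ε fun z => f (-z) := by
  have hshift := intervalIntegral.integral_comp_add_right (a := 0) (b := Real.pi)
    (fun θ : ℝ => f (-(t : ℂ) + ε * exp (θ * I)) * (I * ε * exp (θ * I))) Real.pi
  rw [zero_add, ← two_mul] at hshift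
  rw [lowerArcIntegral, ← hshift, upperArcIntegral, intervalIntegral.integral_symm 0 Real.pi,
    ← intervalIntegral.integral_neg]
  refine intervalIntegral.integral_congr fun θ _ => ?_
  have hexp : exp (((θ + Real.pi : ℝ) : ℂ) * I) = -exp (θ * I) := by
    rw [Complex.ofReal_add, add_mul, Complex.exp_add, Complex.exp_pi_mul_I, mul_neg_one]
  simp only [hexp, mul_neg, ← neg_add]

lemma tendsto_upperArcIntegral
    (hf : Tendsto (fun z => (z - t) * f z) (𝓝[puncturedUpper t] (t : ℂ)) (𝓝 c))
    (hmeas : ∀ᶠ ε in 𝓝[>] (0 : ℝ), AEStronglyMeasurable (fun θ => f (circleMap t ε θ))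
      (volume.restrict (Ioc 0 Real.pi))) :
    Tendsto (fun ε => upperArcIntegral t ε f) (𝓝[>] 0) (𝓝 (-(Real.pi * I) * c)) := by
  have hval : -(Real.pi * I) * c = ∫ _θ in Real.pi..(0 : ℝ), I * c := by
    rw [intervalIntegral.integral_const, Complex.real_smul]
    push_cast
    ring
  obtain ⟨ρ, hρ, hbound⟩ := Metric.mem_nhdsWithin_iff.1
    (hf.norm.eventually_lt_const (lt_add_one ‖c‖))
  simp only [upperArcIntegral_eq, hval]
  refine intervalIntegral.tendsto_integral_filter_of_dominated_convergence
    (fun _ => ‖c‖ + 1) ?_ ?_ intervalIntegrable_const ?_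
  all_goals rw [uIoc_of_ge Real.pi_pos.le]
  · filter_upwards [hmeas] with ε hε
    exact ((by fun_prop : Continuous fun θ => circleMap t ε θ - t).aestronglyMeasurable.mul
      hε).const_mul I
  · filter_upwards [Ioo_mem_nhdsGT hρ] with ε hε
    refine Eventually.of_forall fun θ hθ => ?_
    rw [norm_mul, Complex.norm_I, one_mul]
    refine (hbound ⟨?_, circleMap_mem_puncturedUpper hε.1 hθ⟩).le
    rw [mem_ball_iff_norm, norm_circleMap_sub hε.1.le]
    exact hε.2
  · refine Eventually.of_forall fun θ hθ => Tendsto.const_mul I ?_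
    refine hf.comp (tendsto_nhdsWithin_iff.2 ⟨?_, ?_⟩)
    · refine (Continuous.tendsto' (f := fun ε : ℝ => circleMap t ε θ) ?_ 0 _
        (by simp)).mono_left nhdsWithin_le_nhds
      simp only [circleMap]
      fun_prop
    · filter_upwards [self_mem_nhdsWithin] with ε hε using circleMap_mem_puncturedUpper hε hθ

lemma neg_pi_mul_I_mul_poleCoeff (m t : ℝ) :
    -(Real.pi * I) * poleCoeff m t = 1 / 2 * exp (I * m * t) := by
  have hpi : (Real.pi : ℂ) ≠ 0 := by exact_mod_cast Real.pi_ne_zero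
  rw [poleCoeff]
  field_simp
  linear_combination -Complex.I_sq

lemma IsPropagatorContinuation.aestronglyMeasurable_circleMap
    (hG : IsPropagatorContinuation m t G) {ε : ℝ} (hε : 0 < ε) (hεt : ε < t) :
    AEStronglyMeasurable (fun θ => G (circleMap t ε θ)) (volume.restrict (Ioc 0 Real.pi)) := by
  refine (hG.analytic.continuousOn.comp (by fun_prop) fun θ hθ => ?_).aestronglyMeasurable
    measurableSet_Ioc
  exact mem_contourRegion_of_mem_puncturedUpper (circleMap_mem_puncturedUpper hε hθ)
    ((norm_circleMap_sub hε.le θ).trans_lt hεt)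

lemma IsPropagatorContinuation.tendsto_upperArcIntegral_mul
    (hG : IsPropagatorContinuation m t G) (ht : 0 < t) (hΦ : Measurable Φ)
    (hΦt : ContinuousAt Φ t) :
    Tendsto (fun ε => upperArcIntegral t ε fun z => G z * Φ z) (𝓝[>] 0)
      (𝓝 (1 / 2 * Φ t * exp (I * m * t))) := by
  have hval : 1 / 2 * Φ t * exp (I * m * t) = -(Real.pi * I) * (poleCoeff m t * Φ t) := by
    rw [← mul_assoc, neg_pi_mul_I_mul_poleCoeff]
    ring
  rw [hval]
  refine tendsto_upperArcIntegral ?_ ?_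
  · simpa only [mul_assoc] using
      (hG.tendsto_sub_mul ht).mul (hΦt.tendsto.mono_left nhdsWithin_le_nhds)
  · filter_upwards [Ioo_mem_nhdsGT ht] with ε hε
    exact (hG.aestronglyMeasurable_circleMap hε.1 hε.2).mul
      (hΦ.comp (by fun_prop)).aestronglyMeasurable

lemma IsComplexExtension.continuousAt_comp_const_sub {ψ₀ : ℝ → ℂ} {Ψ : ℂ → ℂ}
    (hΨ : IsComplexExtension ψ₀ Ψ) (x a : ℝ) : ContinuousAt (fun z : ℂ => Ψ (x - z)) a := by
  refine ContinuousAt.comp_of_eq (hΨ.continuousAt_real (x - a)) (by fun_prop) ?_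
  push_cast
  rfl

lemma IsComplexExtension.apply_sub {ψ₀ : ℝ → ℂ} {Ψ : ℂ → ℂ} (hΨ : IsComplexExtension ψ₀ Ψ)
    (x a : ℝ) : Ψ (x - a) = ψ₀ (x - a) := by
  rw [← Complex.ofReal_sub, hΨ.extends_real]

lemma IsPropagatorContinuation.tendsto_arcIntegrals (hG : IsPropagatorContinuation m t G)
    (ht : 0 < t) {ψ₀ : ℝ → ℂ} {Ψ : ℂ → ℂ} (hΨ : IsComplexExtension ψ₀ Ψ) (x : ℝ) :
    Tendsto (fun ε => lowerArcIntegral t ε (fun z => G z * Ψ (x - z)) +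
        upperArcIntegral t ε (fun z => G z * Ψ (x - z))) (𝓝[>] 0)
      (𝓝 (1 / 2 * ψ₀ (x + t) * exp (I * m * t) + 1 / 2 * ψ₀ (x - t) * exp (I * m * t))) := by
  have hupper := hG.tendsto_upperArcIntegral_mul ht (hΨ.measurable.comp (by fun_prop))
    (hΨ.continuousAt_comp_const_sub x t)
  have hlower := hG.comp_neg.tendsto_upperArcIntegral_mul ht (Φ := fun z => Ψ (x - -z))
    (hΨ.measurable.comp (by fun_prop)) ?_
  · have hneg := hΨ.apply_sub x (-t)
    rw [Complex.ofReal_neg, sub_neg_eq_add x t] at hneg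
    rw [hneg] at hlower
    simpa only [lowerArcIntegral_eq_upperArcIntegral, Function.comp_apply, hΨ.apply_sub] using
      hlower.add hupper
  · refine ContinuousAt.comp_of_eq (g := fun z : ℂ => Ψ (x - z))
      (hΨ.continuousAt_comp_const_sub x (-t)) continuousAt_neg ?_
    exact (Complex.ofReal_neg t).symm

lemma IsPropagatorContinuation.hasPrincipalValue_iff_hasContourIntegral
    (hG : IsPropagatorContinuation m t G) (ht : 0 < t) {ψ₀ : ℝ → ℂ} {Ψ : ℂ → ℂ}
    (hΨ : IsComplexExtension ψ₀ Ψ) (x : ℝ) (L : ℂ) :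
    HasPrincipalValue t (fun y : ℝ => G y * ψ₀ (x - y)) L ↔
      HasContourIntegral t (fun z => G z * Ψ (x - z))
        (L + 1 / 2 * ψ₀ (x - t) * exp (I * m * t) + 1 / 2 * ψ₀ (x + t) * exp (I * m * t)) := by
  have harcs := hG.tendsto_arcIntegrals ht hΨ x
  simp only [HasPrincipalValue, HasContourIntegral, indentedContourIntegral, hΨ.apply_sub]
  rw [add_right_comm L]
  simp only [add_assoc]
  exact ⟨fun h => h.add harcs, fun h => by simpa only [add_sub_cancel_right] using h.sub harcs⟩

end Arcs

/-! ### Existence of the principal value -/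

section IntegrableSingularity

lemma locallyIntegrable_abs_sub_rpow (a : ℝ) {β : ℝ} (hβ : -1 < β) :
    LocallyIntegrable fun y : ℝ => |y - a| ^ β := by
  have hzero : LocallyIntegrable fun u : ℝ => |u| ^ β := by
    refine locallyIntegrable_of_norm_le_rpow (α := -β) (C := 1) (by simp) (by simp; linarith)
      (Eventually.of_forall fun u => ?_)
      (by fun_prop : Measurable fun u : ℝ => |u| ^ β).aestronglyMeasurable
    rw [Real.norm_of_nonneg (by positivity), neg_neg, one_mul, Real.norm_eq_abs]
  rw [← map_sub_right_eq_self volume a] at hzero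
  exact (locallyIntegrable_map_homeomorph (Homeomorph.subRight a)).1 hzero

lemma integrableAtFilter_nhds_of_isBigO_rpow {f : ℝ → ℂ} {a β : ℝ} (hβ : -1 < β)
    (hmeas : AEStronglyMeasurable f) (hf : f =O[𝓝[≠] a] fun y => |y - a| ^ β) :
    IntegrableAtFilter f (𝓝 a) := by
  have hle : 𝓝 a ⊓ ae volume ≤ 𝓝[≠] a :=
    inf_le_inf_left _ (le_principal_iff.2 (compl_mem_ae_iff.2 (measure_singleton a)))
  have : (𝓝[≠] a).IsMeasurablyGenerated :=
    (measurableSet_singleton a).compl.nhdsWithin_isMeasurablyGenerated a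
  exact ((hf.integrableAtFilter hmeas.stronglyMeasurableAtFilter
    ((locallyIntegrable_abs_sub_rpow a hβ a).filter_mono nhdsWithin_le_nhds)).filter_mono
      hle).of_inf_ae

lemma integrableAtFilter_mul_sub_pole {g φ : ℝ → ℂ} {a α β : ℝ} {c : ℂ} (hα : 0 < α)
    (hβ : -1 < β) (hg : AEStronglyMeasurable g) (hφ : AEStronglyMeasurable φ)
    (hpole : (fun y : ℝ => g y - c * ((y : ℂ) - a)⁻¹) =O[𝓝[≠] a] fun y => |y - a| ^ β)
    (hholder : (fun y : ℝ => φ y - φ a) =O[𝓝 a] fun y => |y - a| ^ α) :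
    IntegrableAtFilter (fun y : ℝ => g y * φ y - c * φ a * ((y : ℂ) - a)⁻¹) (𝓝 a) := by
  have hinv : AEStronglyMeasurable fun y : ℝ => ((y : ℂ) - a)⁻¹ :=
    (by fun_prop : Measurable fun y : ℝ => ((y : ℂ) - a)⁻¹).aestronglyMeasurable
  have hbounded : (fun y => φ y) =O[𝓝[≠] a] fun _ => (1 : ℝ) := by
    have hzero : Tendsto (fun y : ℝ => |y - a| ^ α) (𝓝 a) (𝓝 0) :=
      Continuous.tendsto' (by fun_prop (disch := simp [hα.le])) _ _ (by simp [hα.ne'])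
    simpa only [sub_add_cancel, zero_add] using
      (((hholder.trans_tendsto hzero).add_const (φ a)).mono_left nhdsWithin_le_nhds).isBigO_one ℝ
  have hregular : IntegrableAtFilter (fun y : ℝ => (g y - c * ((y : ℂ) - a)⁻¹) * φ y) (𝓝 a) :=
    integrableAtFilter_nhds_of_isBigO_rpow hβ ((hg.sub (hinv.const_mul c)).mul hφ)
      (by simpa only [mul_one] using hpole.mul hbounded)
  have hquotient : IntegrableAtFilter
      (fun y : ℝ => c * ((φ y - φ a) * ((y : ℂ) - a)⁻¹)) (𝓝 a) := by
    have hinv_bound : (fun y : ℝ => ((y : ℂ) - a)⁻¹) =O[𝓝[≠] a] fun y => |y - a| ^ (-1 : ℝ) := by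
      refine IsBigO.of_bound' (Eventually.of_forall fun y => ?_)
      rw [Real.rpow_neg_one, norm_inv, norm_inv, ← Complex.ofReal_sub, Complex.norm_real,
        Real.norm_eq_abs, Real.norm_eq_abs, abs_abs]
    refine integrableAtFilter_nhds_of_isBigO_rpow (β := α + -1) (by linarith)
      (((hφ.sub aestronglyMeasurable_const).mul hinv).const_mul c)
      ((((hholder.mono nhdsWithin_le_nhds).mul hinv_bound).const_mul_left c).congr'
        EventuallyEq.rfl ?_)
    filter_upwards [self_mem_nhdsWithin] with y hy
    rw [Real.rpow_add (abs_pos.2 (sub_ne_zero.2 hy))]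
  refine (hregular.add hquotient).congr (Eventually.of_forall fun y => ?_)
  simp only [Pi.add_apply]
  ring

end IntegrableSingularity

section PrincipalValue

variable {t : ℝ} {f : ℝ → ℂ}

lemma mem_ball_sdiff_ball {a ε ρ y : ℝ} :
    y ∈ Metric.ball a ρ \ Metric.ball a ε ↔ |y - a| < ρ ∧ ε ≤ |y - a| := by
  simp [Real.dist_eq]

lemma integrableOn_inv_sub {a ε ρ : ℝ} (hε : 0 < ε) :
    IntegrableOn (fun y : ℝ => ((y : ℂ) - a)⁻¹) (Metric.ball a ρ \ Metric.ball a ε) := by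
  refine Measure.integrableOn_of_bounded (M := ε⁻¹)
    ((measure_mono sdiff_subset).trans_lt measure_ball_lt_top).ne
    (by fun_prop : Measurable fun y : ℝ => ((y : ℂ) - a)⁻¹).aestronglyMeasurable ?_
  filter_upwards [ae_restrict_mem (measurableSet_ball.diff measurableSet_ball)] with y hy
  rw [norm_inv, ← Complex.ofReal_sub, Complex.norm_real, Real.norm_eq_abs]
  exact inv_anti₀ hε (mem_ball_sdiff_ball.1 hy).2

lemma setIntegral_inv_sub_eq_zero (a ε ρ : ℝ) :
    ∫ y in Metric.ball a ρ \ Metric.ball a ε, ((y : ℂ) - a)⁻¹ = 0 := by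
  rw [← integral_indicator (measurableSet_ball.diff measurableSet_ball)]
  set F : ℝ → ℂ :=
    (Metric.ball a ρ \ Metric.ball a ε).indicator fun y : ℝ => ((y : ℂ) - a)⁻¹ with hF
  have hodd : ∀ y, F (a + a - y) = -F y := fun y => by
    have hsub : a + a - y - a = -(y - a) := by ring
    have hmem : a + a - y ∈ Metric.ball a ρ \ Metric.ball a ε ↔
        y ∈ Metric.ball a ρ \ Metric.ball a ε := by
      simp only [mem_ball_sdiff_ball, hsub, abs_neg]
    by_cases hy : y ∈ Metric.ball a ρ \ Metric.ball a ε
    · rw [hF, indicator_of_mem hy, indicator_of_mem (hmem.2 hy), ← Complex.ofReal_sub, hsub,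
        Complex.ofReal_neg, inv_neg, Complex.ofReal_sub]
    · rw [hF, indicator_of_notMem hy, indicator_of_notMem (hmem.not.2 hy), neg_zero]
  have hreflect := integral_sub_left_eq_self F volume (a + a)
  simp only [hodd, integral_neg] at hreflect
  exact neg_eq_self.1 hreflect

lemma setIntegral_sub_pole_eq {a ε ρ : ℝ} {c : ℂ} (hε : 0 < ε) (hερ : ε ≤ ρ)
    (hf : IntegrableOn (fun y : ℝ => f y - c * ((y : ℂ) - a)⁻¹) (Metric.ball a ρ)) :
    ∫ y in Metric.ball a ρ, (f y - c * ((y : ℂ) - a)⁻¹) =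
      (∫ y in Metric.ball a ρ \ Metric.ball a ε, f y) +
        ∫ y in Metric.ball a ε, (f y - c * ((y : ℂ) - a)⁻¹) := by
  rw [← sub_eq_iff_eq_add,
    ← setIntegral_sdiff measurableSet_ball hf (Metric.ball_subset_ball hερ)]
  calc ∫ y in Metric.ball a ρ \ Metric.ball a ε, (f y - c * ((y : ℂ) - a)⁻¹)
      = (∫ y in Metric.ball a ρ \ Metric.ball a ε, (f y - c * ((y : ℂ) - a)⁻¹)) +
          ∫ y in Metric.ball a ρ \ Metric.ball a ε, c * ((y : ℂ) - a)⁻¹ := by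
        rw [integral_const_mul, setIntegral_inv_sub_eq_zero, mul_zero, add_zero]
    _ = ∫ y in Metric.ball a ρ \ Metric.ball a ε, f y := by
        rw [← integral_add (hf.mono_set sdiff_subset) ((integrableOn_inv_sub hε).const_mul c)]
        simp only [sub_add_cancel]

lemma tendsto_setIntegral_ball_sdiff_ball {a ρ : ℝ} {c : ℂ} (hρ : 0 < ρ)
    (hf : IntegrableOn (fun y : ℝ => f y - c * ((y : ℂ) - a)⁻¹) (Metric.ball a ρ)) :
    Tendsto (fun ε => ∫ y in Metric.ball a ρ \ Metric.ball a ε, f y) (𝓝[>] 0)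
      (𝓝 (∫ y in Metric.ball a ρ, (f y - c * ((y : ℂ) - a)⁻¹))) := by
  have hvol : Tendsto (fun ε : ℝ => volume (Metric.ball a ε)) (𝓝[>] 0) (𝓝 0) := by
    simp only [Real.volume_ball]
    exact (Continuous.tendsto' (ENNReal.continuous_ofReal.comp (by fun_prop)) 0 _
      (by simp)).mono_left nhdsWithin_le_nhds
  have hlim := (hf.integrable.tendsto_setIntegral_nhds_zero (s := fun ε => Metric.ball a ε)
    (tendsto_of_tendsto_of_tendsto_of_le_of_le tendsto_const_nhds hvol (fun _ => zero_le)
      fun ε => Measure.restrict_apply_le _ _)).const_sub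
        (∫ y in Metric.ball a ρ, (f y - c * ((y : ℂ) - a)⁻¹))
  rw [sub_zero] at hlim
  refine hlim.congr' ?_
  filter_upwards [Ioo_mem_nhdsGT hρ] with ε hε
  rw [Measure.restrict_restrict_of_subset (Metric.ball_subset_ball hε.2.le),
    setIntegral_sub_pole_eq hε.1 hε.2.le hf, add_sub_cancel_right]

lemma offPoles_eq (t ε : ℝ) : offPoles t ε = (Metric.ball t ε ∪ Metric.ball (-t) ε)ᶜ := by
  ext y
  simp [offPoles, Real.dist_eq]

lemma measurableSet_offPoles (t ε : ℝ) : MeasurableSet (offPoles t ε) := by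
  rw [offPoles_eq]
  exact (measurableSet_ball.union measurableSet_ball).compl

lemma disjoint_ball_ball_neg {ρ : ℝ} (hρ : ρ ≤ t) :
    Disjoint (Metric.ball t ρ) (Metric.ball (-t) ρ) := by
  refine Metric.ball_disjoint_ball ?_
  rw [Real.dist_eq]
  exact le_trans (by linarith) (le_abs_self _)

lemma offPoles_eq_union {ε ρ : ℝ} (hε : ε ≤ ρ) (hρ : ρ ≤ t) :
    offPoles t ε = offPoles t ρ ∪ ((Metric.ball t ρ \ Metric.ball t ε) ∪
      (Metric.ball (-t) ρ \ Metric.ball (-t) ε)) := by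
  have hdisj := disjoint_ball_ball_neg hρ
  have hpos := Metric.ball_subset_ball (x := t) hε
  have hneg := Metric.ball_subset_ball (x := -t) hε
  simp only [offPoles_eq]
  rw [Set.disjoint_left] at hdisj
  ext y
  have := @hdisj y
  have := @hpos y
  have := @hneg y
  simp only [mem_union, mem_compl_iff, Set.mem_sdiff]
  tauto

lemma setIntegral_offPoles {ε ρ : ℝ} (hε : ε ≤ ρ) (hρ : ρ ≤ t)
    (hf : IntegrableOn f (offPoles t ε)) :
    ∫ y in offPoles t ε, f y = (∫ y in offPoles t ρ, f y) +
      ((∫ y in Metric.ball t ρ \ Metric.ball t ε, f y) +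
        ∫ y in Metric.ball (-t) ρ \ Metric.ball (-t) ε, f y) := by
  rw [offPoles_eq_union hε hρ] at hf ⊢
  rw [setIntegral_union _ _ hf.left_of_union hf.right_of_union,
    setIntegral_union ((disjoint_ball_ball_neg hρ).mono sdiff_subset sdiff_subset)
      (measurableSet_ball.diff measurableSet_ball)
      hf.right_of_union.left_of_union hf.right_of_union.right_of_union]
  · rw [offPoles_eq]
    exact disjoint_compl_left.mono_right (union_subset_union sdiff_subset sdiff_subset)
  · exact (measurableSet_ball.diff measurableSet_ball).union
      (measurableSet_ball.diff measurableSet_ball)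

lemma exists_hasPrincipalValue {c₁ c₂ : ℂ} (ht : 0 < t)
    (hf : ∀ ε > 0, IntegrableOn f (offPoles t ε))
    (hpos : IntegrableAtFilter (fun y : ℝ => f y - c₁ * ((y : ℂ) - t)⁻¹) (𝓝 t))
    (hneg : IntegrableAtFilter (fun y : ℝ => f y - c₂ * ((y : ℂ) - (-t : ℝ))⁻¹) (𝓝 (-t))) :
    ∃ L, HasPrincipalValue t f L := by
  obtain ⟨s₁, hs₁, hint₁⟩ := hpos
  obtain ⟨s₂, hs₂, hint₂⟩ := hneg
  obtain ⟨ρ₁, hρ₁, hball₁⟩ := Metric.mem_nhds_iff.1 hs₁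
  obtain ⟨ρ₂, hρ₂, hball₂⟩ := Metric.mem_nhds_iff.1 hs₂
  set ρ := min t (min ρ₁ ρ₂)
  have hρ : 0 < ρ := lt_min ht (lt_min hρ₁ hρ₂)
  have hle₁ : ρ ≤ ρ₁ := (min_le_right _ _).trans (min_le_left _ _)
  have hle₂ : ρ ≤ ρ₂ := (min_le_right _ _).trans (min_le_right _ _)
  have hlim₁ := tendsto_setIntegral_ball_sdiff_ball hρ
    (hint₁.mono_set ((Metric.ball_subset_ball hle₁).trans hball₁))
  have hlim₂ := tendsto_setIntegral_ball_sdiff_ball hρ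
    (hint₂.mono_set ((Metric.ball_subset_ball hle₂).trans hball₂))
  refine ⟨_, ((hlim₁.add hlim₂).const_add (∫ y in offPoles t ρ, f y)).congr' ?_⟩
  filter_upwards [Ioo_mem_nhdsGT hρ] with ε hε
  exact (setIntegral_offPoles hε.2.le (min_le_left _ _) (hf ε hε.1)).symm

end PrincipalValue

section Holder

variable {m t : ℝ} {G : ℂ → ℂ} {ψ₀ : ℝ → ℂ}

lemma IsPropagatorContinuation.isBigO_ofReal_sub_pole (hG : IsPropagatorContinuation m t G)
    (ht : 0 < t) :
    (fun y : ℝ => G y - poleCoeff m t * ((y : ℂ) - t)⁻¹) =O[𝓝[≠] t]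
      fun y => |y - t| ^ (-(1 / 2) : ℝ) := by
  have htend : Tendsto (fun y : ℝ => (y : ℂ)) (𝓝[≠] t) (𝓝[puncturedUpper t] (t : ℂ)) := by
    refine tendsto_nhdsWithin_iff.2
      ⟨(Complex.continuous_ofReal.tendsto t).mono_left nhdsWithin_le_nhds, ?_⟩
    filter_upwards [self_mem_nhdsWithin] with y hy
    exact ⟨fun h => hy (Complex.ofReal_injective h), by simp⟩
  refine ((hG.isBigO_sub_pole ht).comp_tendsto htend).congr (fun y => ?_) fun y => ?_
  · simp only [Function.comp_apply, div_eq_mul_inv]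
  · simp only [Function.comp_apply, ← Complex.ofReal_sub, Complex.norm_real, Real.norm_eq_abs]

lemma IsPropagatorContinuation.isBigO_ofReal_sub_pole_neg (hG : IsPropagatorContinuation m t G)
    (ht : 0 < t) :
    (fun y : ℝ => G y - -poleCoeff m t * ((y : ℂ) - (-t : ℝ))⁻¹) =O[𝓝[≠] (-t)]
      fun y => |y - -t| ^ (-(1 / 2) : ℝ) := by
  have htend : Tendsto (fun y : ℝ => -y) (𝓝[≠] (-t)) (𝓝[≠] t) :=
    (continuous_neg.tendsto' (-t) t (neg_neg t)).inf
      (tendsto_principal_principal.2 fun y hy h => hy (neg_eq_iff_eq_neg.1 h))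
  refine ((hG.comp_neg.isBigO_ofReal_sub_pole ht).comp_tendsto htend).congr
    (fun y => ?_) fun y => ?_
  · simp only [Function.comp_apply, Complex.ofReal_neg, neg_neg, sub_neg_eq_add, ← neg_add',
      inv_neg, neg_mul, mul_neg]
  · simp only [Function.comp_apply, ← neg_add', abs_neg, sub_neg_eq_add]

lemma isBigO_sub_comp_const_sub {x a α : ℝ}
    (h : (fun y => ψ₀ y - ψ₀ (x - a)) =O[𝓝 (x - a)] fun y => |y - (x - a)| ^ α) :
    (fun y => ψ₀ (x - y) - ψ₀ (x - a)) =O[𝓝 a] fun y => |y - a| ^ α := by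
  have htend : Tendsto (fun y : ℝ => x - y) (𝓝 a) (𝓝 (x - a)) := tendsto_id.const_sub x
  refine (h.comp_tendsto htend).congr (fun y => rfl) fun y => ?_
  simp only [Function.comp_apply, sub_sub_sub_cancel_left, abs_sub_comm a y]

lemma exists_norm_halfLinePropagator_ofReal_le (m : ℝ) (τ : ℂ) {ε : ℝ} (hε : 0 < ε) :
    ∃ C, ∀ u : ℝ, ε ≤ |u| → ‖halfLinePropagator m τ u‖ ≤ C := by
  obtain ⟨K, hK⟩ := norm_halfLinePropagator_sub_le m τ
  refine ⟨|K| * ε ^ (-(1 / 2) : ℝ) + ε⁻¹, fun u hu => ?_⟩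
  have hu₀ : (u : ℂ) ≠ 0 := Complex.ofReal_ne_zero.2 (abs_pos.1 (hε.trans_le hu))
  have hpole : ‖I / (u : ℂ)‖ ≤ ε⁻¹ := by
    rw [norm_div, Complex.norm_I, Complex.norm_real, Real.norm_eq_abs, one_div]
    exact inv_anti₀ hε hu
  have hrest := hK u hu₀ (Complex.ofReal_im u).ge
  rw [Complex.norm_real, Real.norm_eq_abs] at hrest
  have hpow : |u| ^ (-(1 / 2) : ℝ) ≤ ε ^ (-(1 / 2) : ℝ) :=
    Real.rpow_le_rpow_of_nonpos hε hu (by norm_num)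
  calc ‖halfLinePropagator m τ u‖
      ≤ ‖halfLinePropagator m τ u - I / u‖ + ‖I / (u : ℂ)‖ := by
        simpa using norm_add_le (halfLinePropagator m τ u - I / u) (I / (u : ℂ))
    _ ≤ |K| * ε ^ (-(1 / 2) : ℝ) + ε⁻¹ := by
        gcongr
        exact hrest.trans (mul_le_mul (le_abs_self K) hpow (by positivity) (abs_nonneg K))

lemma exists_norm_propagator_ofReal_le (m t : ℝ) {ε : ℝ} (hε : 0 < ε) :
    ∃ C, ∀ y ∈ offPoles t ε, ‖propagator m t y‖ ≤ C := by
  obtain ⟨C, hC⟩ := exists_norm_halfLinePropagator_ofReal_le m t hε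
  refine ⟨‖(1 / (2 * Real.pi) : ℂ)‖ * (‖exp (I * m * t)‖ * (C + C)), fun y hy => ?_⟩
  rw [propagator, norm_mul, norm_mul]
  gcongr
  refine (norm_add_le _ _).trans (add_le_add ?_ ?_)
  · simpa using hC (y - t) hy.1
  · simpa using hC (-y - t) (by rw [← neg_add', abs_neg]; exact hy.2)

lemma IsPropagatorContinuation.aestronglyMeasurable_ofReal
    (hG : IsPropagatorContinuation m t G) : AEStronglyMeasurable fun y : ℝ => G y := by
  have hfin : ({t, -t} : Set ℝ).Finite := toFinite _
  have hcont : ContinuousOn (fun y : ℝ => G y) ({t, -t} : Set ℝ)ᶜ := by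
    refine hG.analytic.continuousOn.comp (by fun_prop) fun y hy => ?_
    simp only [mem_compl_iff, mem_insert_iff, mem_singleton_iff, not_or] at hy
    exact ofReal_mem_contourRegion hy.1 hy.2
  have h := hcont.aestronglyMeasurable (μ := volume) hfin.measurableSet.compl
  rwa [Measure.restrict_eq_self_of_ae_mem (s := ({t, -t} : Set ℝ)ᶜ)
    (hfin.countable.ae_notMem volume)] at h

lemma IsPropagatorContinuation.integrableOn_offPoles (hG : IsPropagatorContinuation m t G)
    {φ : ℝ → ℂ} (hφ : Integrable φ) {ε : ℝ} (hε : 0 < ε) :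
    IntegrableOn (fun y : ℝ => G y * φ y) (offPoles t ε) := by
  obtain ⟨C, hC⟩ := exists_norm_propagator_ofReal_le m t hε
  refine hφ.integrableOn.bdd_mul (c := C) hG.aestronglyMeasurable_ofReal.restrict ?_
  filter_upwards [ae_restrict_mem (measurableSet_offPoles t ε)] with y hy
  have hpos : y ≠ t := sub_ne_zero.1 (abs_pos.1 (hε.trans_le hy.1))
  have hneg : y ≠ -t := fun h => (hε.trans_le hy.2).ne' (by rw [h, neg_add_cancel, abs_zero])
  rw [hG.eq_ofReal (isPropagatorContinuation_propagator m t) hpos hneg]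
  exact hC y hy

lemma IsPropagatorContinuation.exists_hasPrincipalValue (hG : IsPropagatorContinuation m t G)
    (ht : 0 < t) (hψ : Integrable ψ₀) {x α : ℝ} (hα : 0 < α)
    (hsub : (fun y => ψ₀ y - ψ₀ (x - t)) =O[𝓝 (x - t)] fun y => |y - (x - t)| ^ α)
    (hadd : (fun y => ψ₀ y - ψ₀ (x + t)) =O[𝓝 (x + t)] fun y => |y - (x + t)| ^ α) :
    ∃ L, HasPrincipalValue t (fun y : ℝ => G y * ψ₀ (x - y)) L := by
  have hφ : Integrable fun y => ψ₀ (x - y) := hψ.comp_sub_left x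
  rw [← sub_neg_eq_add] at hadd
  exact Salpeter.exists_hasPrincipalValue ht (fun ε hε => hG.integrableOn_offPoles hφ hε)
    (integrableAtFilter_mul_sub_pole hα (by norm_num) hG.aestronglyMeasurable_ofReal
      hφ.aestronglyMeasurable (hG.isBigO_ofReal_sub_pole ht) (isBigO_sub_comp_const_sub hsub))
    (integrableAtFilter_mul_sub_pole hα (by norm_num) hG.aestronglyMeasurable_ofReal
      hφ.aestronglyMeasurable (hG.isBigO_ofReal_sub_pole_neg ht) (isBigO_sub_comp_const_sub hadd))

end Holder

end Salpeter

end

theorem mainTheorem8_general (m t : ℝ) (ht : 0 < t) :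
    (∃ G : ℂ → ℂ, Salpeter.IsPropagatorContinuation m t G ∧
      ∀ G' : ℂ → ℂ, Salpeter.IsPropagatorContinuation m t G' →
        Set.EqOn G' G (Salpeter.contourRegion t)) ∧
    ∀ G : ℂ → ℂ, Salpeter.IsPropagatorContinuation m t G →
      ∀ (ψ₀ : ℝ → ℂ) (Ψ : ℂ → ℂ), Salpeter.IsComplexExtension ψ₀ Ψ → ∀ x : ℝ,
        (∀ L : ℂ,
          Salpeter.HasPrincipalValue t (fun y : ℝ => G (y : ℂ) * ψ₀ (x - y)) L ↔
          Salpeter.HasContourIntegral t (fun z : ℂ => G z * Ψ ((x : ℂ) - z))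
            (L + 1 / 2 * ψ₀ (x - t) * Complex.exp (Complex.I * m * t)
               + 1 / 2 * ψ₀ (x + t) * Complex.exp (Complex.I * m * t))) ∧
        (Integrable ψ₀ → (∃ α : ℝ, 0 < α ∧
            (fun y : ℝ => ψ₀ y - ψ₀ (x - t)) =O[𝓝 (x - t)] (fun y : ℝ => |y - (x - t)| ^ α) ∧
            (fun y : ℝ => ψ₀ y - ψ₀ (x + t)) =O[𝓝 (x + t)] (fun y : ℝ => |y - (x + t)| ^ α)) →
          ∃ L : ℂ,
            Salpeter.HasPrincipalValue t (fun y : ℝ => G (y : ℂ) * ψ₀ (x - y)) L ∧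
            Salpeter.HasContourIntegral t (fun z : ℂ => G z * Ψ ((x : ℂ) - z))
              (L + 1 / 2 * ψ₀ (x - t) * Complex.exp (Complex.I * m * t)
                 + 1 / 2 * ψ₀ (x + t) * Complex.exp (Complex.I * m * t))) := by
  have hcont := Salpeter.isPropagatorContinuation_propagator m t
  refine ⟨⟨_, hcont, fun G' hG' => hG'.eqOn hcont⟩, fun G hG ψ₀ Ψ hΨ x => ?_⟩
  have hiff := hG.hasPrincipalValue_iff_hasContourIntegral ht hΨ x
  refine ⟨hiff, fun hψ ⟨α, hα, hsub, hadd⟩ => ?_⟩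
  obtain ⟨L, hL⟩ := hG.exists_hasPrincipalValue ht hψ hα hsub hadd
  exact ⟨L, hL, (hiff L).1 hL⟩

theorem mainTheorem8 (m t : ℝ) (hm : 0 ≤ m) (ht : 0 < t) :
    (∃ G : ℂ → ℂ, Salpeter.IsPropagatorContinuation m t G ∧
      ∀ G' : ℂ → ℂ, Salpeter.IsPropagatorContinuation m t G' →
        Set.EqOn G' G (Salpeter.contourRegion t)) ∧
    ∀ G : ℂ → ℂ, Salpeter.IsPropagatorContinuation m t G →
      ∀ (ψ₀ : ℝ → ℂ) (Ψ : ℂ → ℂ), Continuous ψ₀ → HasCompactSupport ψ₀ →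
        Salpeter.IsComplexExtension ψ₀ Ψ → ∀ x : ℝ,
        (∀ L : ℂ,
          Salpeter.HasPrincipalValue t (fun y : ℝ => G (y : ℂ) * ψ₀ (x - y)) L ↔
          Salpeter.HasContourIntegral t (fun z : ℂ => G z * Ψ ((x : ℂ) - z))
            (L + 1 / 2 * ψ₀ (x - t) * Complex.exp (Complex.I * m * t)
               + 1 / 2 * ψ₀ (x + t) * Complex.exp (Complex.I * m * t))) ∧
        ((∃ α : ℝ, 0 < α ∧
            (fun y : ℝ => ψ₀ y - ψ₀ (x - t)) =O[𝓝 (x - t)] (fun y : ℝ => |y - (x - t)| ^ α) ∧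
            (fun y : ℝ => ψ₀ y - ψ₀ (x + t)) =O[𝓝 (x + t)] (fun y : ℝ => |y - (x + t)| ^ α)) →
          ∃ L : ℂ,
            Salpeter.HasPrincipalValue t (fun y : ℝ => G (y : ℂ) * ψ₀ (x - y)) L ∧
            Salpeter.HasContourIntegral t (fun z : ℂ => G z * Ψ ((x : ℂ) - z))
              (L + 1 / 2 * ψ₀ (x - t) * Complex.exp (Complex.I * m * t)
                 + 1 / 2 * ψ₀ (x + t) * Complex.exp (Complex.I * m * t))) := by
  obtain ⟨hexists, h⟩ := mainTheorem8_general m t ht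
  exact ⟨hexists, fun G hG ψ₀ Ψ hψ hψs hΨ x =>
    (h G hG ψ₀ Ψ hΨ x).imp_right fun hHolder => hHolder (hψ.integrable_of_hasCompactSupport hψs)⟩
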